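/- **Setting.** Let $n\ge 0$ and let $\Gamma$ be a quiver with vertices $1,\dots,n$ whose underlying graph is the Dynkin diagram $A_n$ (with any orientation). Let $\mathbb F$ be a field. For $\alpha=\sum_i c_i\alpha_i$ with $c_i\in\mathbb Z_{\ge 0}$, let $R_\alpha$ be the KLR algebra of $\Gamma$ over $\mathbb F$, with generators $e(\boldsymbol w)$, $y_r$, $\psi_r$, where $\boldsymbol w$ runs over the words of length $d=\sum_i c_i$ in which each letter $i$ occurs $c_i$ times. Two such words are joined by an edge of the weight graph $G_\alpha$ if one arises from the other by swapping two consecutive letters $a,b$ with $|a-b|>1$. A connected component $C$ of $G_\alpha$ is *homogeneous* if in every word $\boldsymbol w\in C$ any two occurrences of a letter $a$ have between them at least two positions carrying letters from $\{a-1,a+1\}$. For such a $C$, let $S(C)$ be the $R_\alpha$-module with $\mathbb F$-basis $\{v_{\boldsymbol w} : \boldsymbol w\in C\}$ and action $$e(\boldsymbol w')v_{\boldsymbol w}=\delta_{\boldsymbol w\boldsymbol w'}v_{\boldsymbol w},\qquad y_rv_{\boldsymbol w}=0,\qquad \psi_rv_{\boldsymbol w}=\begin{cases}v_{s_r\boldsymbol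 w}&\text{if } s_r\boldsymbol w\in C,\\0&\text{otherwise,}\end{cases}$$ where $s_r\boldsymbol w$ is $\boldsymbol w$ with its $r$-th and $(r+1)$-st letters swapped. **Dyck paths.** Let $D$ be a Dyck path of semi-length $n+1$, that is, a lattice path from $(0,0)$ to $(2n+2,0)$ with steps $\langle 1,1\rangle$ and $\langle 1,-1\rangle$ that never goes below the $x$-axis. A *peak* is a rise followed by a fall, and its *height* is the height of its summit. An *ascent* is a maximal run of consecutive rises. For $1\le i\le j\le n$, the *block* $T_i^j$ is the unit diamond with summit $(i+j,\,j-i+2)$, labelled by the word $[j,j-1,\dots,i]$. A summit of a peak of $D$ of height at least $2$ is the summit of exactly one block. Reading the labels of these blocks from left to right (peaks of height $1$ contribute nothing) gives a word. The component $\Psi(D)$ of this word in the weight graph is homogeneous. **Extended ascents.** For each peak of $D$ with summit $(x,y)$, the segment of slope $1$ from $(x-y,0)$ to $(x,y)$ is an *extended ascent* of $D$. The block $T_i^j$ lies on it if its upper left edge does. For a block $T_i^j$ on an extended ascent, the path $P_D(i,j)$ is drawn as follows. 1. It rises from $(2i-2,0)$ to the summit of $T_i^j$. 2. From there it descends until it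 returns to the $x$-axis, where it ends, or until it hits another extended ascent at positive height. 3. In the latter case it takes one step up and continues as in step 2. Put $p_D(i,j)=(\text{number of rises of }P_D(i,j))-1$. **Proposition 3.1.** Suppose that every ascent of $D$ of length greater than $1$ begins on the $x$-axis. Then $$\dim_{\mathbb F} S(\Psi(D))=\frac{k!}{\prod p_D(i,j)},\qquad k=(\text{sum of the peak heights of }D)-(\text{number of peaks of }D),$$ where the product runs over all blocks $T_i^j$ on the extended ascents of $D$. -/

import Mathlib

namespace KLRDyck

noncomputable section

/-! ### Quivers, words and KLR algebras -/

/-- A quiver on the vertex set `I` with at most one arrow between two vertices and no loops. -/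
structure SimpleQuiver (I : Type*) where
  /-- `arr i j` means `i → j`. -/
  arr : I → I → Prop
  asymm : ∀ i j, arr i j → ¬ arr j i

namespace SimpleQuiver

/-- `i` and `j` are neighbors: `i → j` or `i ← j`. -/
def Nbr {I : Type*} (Q : SimpleQuiver I) (i j : I) : Prop := Q.arr i j ∨ Q.arr j i

/-- A quiver whose underlying graph is the Dynkin diagram `A_n` (any orientation). The vertex of
the diagram labelled `a`, `1 ≤ a ≤ n`, is the element of `Fin n` with value `a - 1`. -/
def IsTypeA {n : ℕ} (Q : SimpleQuiver (Fin n)) : Prop :=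
  ∀ i j : Fin n, Q.Nbr i j ↔ (i.val + 1 = j.val ∨ j.val + 1 = i.val)

theorem Nbr.symm {I : Type*} {Q : SimpleQuiver I} {i j : I} (h : Q.Nbr i j) : Q.Nbr j i :=
  Or.symm h

theorem not_nbr_self {I : Type*} (Q : SimpleQuiver I) (i : I) : ¬ Q.Nbr i i := by
  rintro (h | h) <;> exact Q.asymm _ _ h h

end SimpleQuiver

section Words

variable {I : Type*} [Fintype I] [DecidableEq I]

/-- The height of `α = ∑ c_i α_i ∈ Q_+` (given by its coefficients `c : I → ℕ`). -/
def height (α : I → ℕ) : ℕ := ∑ i, α i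

/-- Words of content `α`: the letter `i` occurs exactly `α i` times. -/
def Word (α : I → ℕ) : Type _ :=
  {w : Fin (height α) → I // ∀ i, (Finset.univ.filter fun r => w r = i).card = α i}

instance (α : I → ℕ) : CoeFun (Word α) (fun _ => Fin (height α) → I) := ⟨Subtype.val⟩

instance (α : I → ℕ) : DecidableEq (Word α) :=
  inferInstanceAs (DecidableEq {w : Fin (height α) → I //
    ∀ i, (Finset.univ.filter fun r => w r = i).card = α i})

instance (α : I → ℕ) : Fintype (Word α) :=
  inferInstanceAs (Fintype {w : Fin (height α) → I //
    ∀ i, (Finset.univ.filter fun r => w r = i).card = α i})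

/-- The first of the two consecutive positions exchanged by the simple transposition with
(zero-based) index `k`. -/
def lo {d k : ℕ} (hk : k + 1 < d) : Fin d := ⟨k, Nat.lt_of_succ_lt hk⟩

/-- The second of the two consecutive positions exchanged by the simple transposition with
(zero-based) index `k`. -/
def hi {d k : ℕ} (hk : k + 1 < d) : Fin d := ⟨k + 1, hk⟩

/-- The action of a simple transposition on words: swap the letters in the consecutive positions
`k` and `k + 1`. -/
def Word.swap {α : I → ℕ} (k : ℕ) (hk : k + 1 < height α) (w : Word α) : Word α :=
  ⟨fun r => w (Equiv.swap (lo hk) (hi hk) r), fun i => by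
    rw [← w.2 i]
    exact Finset.card_equiv (Equiv.swap (lo hk) (hi hk)) (by simp)⟩

/-- The generators of `R_α`. Positions are zero-based. -/
inductive KLRGen (α : I → ℕ) : Type _
  | e (w : Word α) : KLRGen α
  | y (k : Fin (height α)) : KLRGen α
  | psi (k : ℕ) (hk : k + 1 < height α) : KLRGen α

variable (F : Type*) [Field F]

/-- The generator `e(w)` in the free algebra. -/
abbrev genE {α : I → ℕ} (w : Word α) : FreeAlgebra F (KLRGen α) := FreeAlgebra.ι F (.e w)

/-- The generator `y_k` in the free algebra. -/
abbrev genY {α : I → ℕ} (k : Fin (height α)) : FreeAlgebra F (KLRGen α) := FreeAlgebra.ι F (.y k)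

/-- The generator `ψ_k` in the free algebra. -/
abbrev genPsi {α : I → ℕ} (k : ℕ) (hk : k + 1 < height α) : FreeAlgebra F (KLRGen α) :=
  FreeAlgebra.ι F (.psi k hk)

open scoped Classical in
/-- The defining relations of the KLR algebra `R_α`. -/
inductive KLRRel (Q : SimpleQuiver I) (α : I → ℕ) :
    FreeAlgebra F (KLRGen α) → FreeAlgebra F (KLRGen α) → Prop
  | e_e (w v : Word α) : KLRRel Q α (genE F w * genE F v) (if w = v then genE F w else 0)
  | sum_e : KLRRel Q α (∑ w : Word α, genE F w) 1
  | y_e (k : Fin (height α)) (w : Word α) :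
      KLRRel Q α (genY F k * genE F w) (genE F w * genY F k)
  | psi_e (k : ℕ) (hk : k + 1 < height α) (w : Word α) :
      KLRRel Q α (genPsi F k hk * genE F w) (genE F (w.swap k hk) * genPsi F k hk)
  | y_y (k l : Fin (height α)) : KLRRel Q α (genY F k * genY F l) (genY F l * genY F k)
  | y_psi (k : Fin (height α)) (l : ℕ) (hl : l + 1 < height α) (h : k ≠ lo hl) (h' : k ≠ hi hl) :
      KLRRel Q α (genY F k * genPsi F l hl) (genPsi F l hl * genY F k)
  | y_psi_left (k : ℕ) (hk : k + 1 < height α) (w : Word α) :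
      KLRRel Q α
        ((genY F (hi hk) * genPsi F k hk - genPsi F k hk * genY F (lo hk)) * genE F w)
        (if w (lo hk) = w (hi hk) then genE F w else 0)
  | psi_y_left (k : ℕ) (hk : k + 1 < height α) (w : Word α) :
      KLRRel Q α
        ((genPsi F k hk * genY F (hi hk) - genY F (lo hk) * genPsi F k hk) * genE F w)
        (if w (lo hk) = w (hi hk) then genE F w else 0)
  | psi_sq (k : ℕ) (hk : k + 1 < height α) (w : Word α) :
      KLRRel Q α (genPsi F k hk * genPsi F k hk * genE F w)
        (if w (lo hk) = w (hi hk) then 0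
        else if Q.arr (w (lo hk)) (w (hi hk)) then (genY F (lo hk) - genY F (hi hk)) * genE F w
        else if Q.arr (w (hi hk)) (w (lo hk)) then (genY F (hi hk) - genY F (lo hk)) * genE F w
        else genE F w)
  | psi_psi (k l : ℕ) (hk : k + 1 < height α) (hl : l + 1 < height α)
      (h : k + 1 < l ∨ l + 1 < k) :
      KLRRel Q α (genPsi F k hk * genPsi F l hl) (genPsi F l hl * genPsi F k hk)
  | braid (k : ℕ) (hk : k + 1 < height α) (hk' : k + 1 + 1 < height α) (w : Word α) :
      KLRRel Q α
        ((genPsi F (k + 1) hk' * genPsi F k hk * genPsi F (k + 1) hk' -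
          genPsi F k hk * genPsi F (k + 1) hk' * genPsi F k hk) * genE F w)
        (if w (hi hk') = w (lo hk) ∧ Q.arr (w (lo hk)) (w (hi hk)) then genE F w
        else if w (hi hk') = w (lo hk) ∧ Q.arr (w (hi hk)) (w (lo hk)) then - genE F w
        else 0)

/-- The Khovanov–Lauda–Rouquier algebra `R_α` of the quiver `Q` over the field `F`. -/
def KLRAlgebra (Q : SimpleQuiver I) (α : I → ℕ) : Type _ := RingQuot (KLRRel F Q α)

instance (Q : SimpleQuiver I) (α : I → ℕ) : Ring (KLRAlgebra F Q α) :=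
  inferInstanceAs (Ring (RingQuot (KLRRel F Q α)))

instance (Q : SimpleQuiver I) (α : I → ℕ) : Algebra F (KLRAlgebra F Q α) :=
  inferInstanceAs (Algebra F (RingQuot (KLRRel F Q α)))

/-! ### Homogeneous components of the weight graph -/

/-- The transposition of the letters in the positions `k`, `k + 1` is admissible for `w`. -/
def Admissible (Q : SimpleQuiver I) {α : I → ℕ} (w : Word α) (k : ℕ) (hk : k + 1 < height α) :
    Prop :=
  w (lo hk) ≠ w (hi hk) ∧ ¬ Q.Nbr (w (lo hk)) (w (hi hk))

variable {F}

@[simp] theorem Word.swap_apply {α : I → ℕ} (k : ℕ) (hk : k + 1 < height α) (w : Word α)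
    (r : Fin (height α)) : w.swap k hk r = w (Equiv.swap (lo hk) (hi hk) r) := rfl

@[simp] theorem Word.swap_swap {α : I → ℕ} (k : ℕ) (hk : k + 1 < height α) (w : Word α) :
    (w.swap k hk).swap k hk = w := Subtype.ext (by funext r; simp)

theorem Admissible.swap {Q : SimpleQuiver I} {α : I → ℕ} {w : Word α} {k : ℕ}
    {hk : k + 1 < height α} (h : Admissible Q w k hk) : Admissible Q (w.swap k hk) k hk := by
  refine ⟨?_, ?_⟩
  · simpa using h.1.symm
  · simpa using fun h' => h.2 (SimpleQuiver.Nbr.symm h')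

/-- The weight graph `G_α`. -/
def weightGraph (Q : SimpleQuiver I) (α : I → ℕ) : SimpleGraph (Word α) where
  Adj w v := ∃ (k : ℕ) (hk : k + 1 < height α), Admissible Q w k hk ∧ w.swap k hk = v
  symm := ⟨by
    rintro w v ⟨k, hk, h, rfl⟩
    exact ⟨k, hk, h.swap, by simp⟩⟩
  loopless := ⟨by
    rintro w ⟨k, hk, h, h'⟩
    apply h.1
    have := congrArg (fun v : Word α => v (lo hk)) h'
    simpa using this.symm⟩

/-- A homogeneous word: between any two occurrences of a letter there are at least two positions
carrying neighbors of that letter. -/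
def IsHomogeneousWord (Q : SimpleQuiver I) {α : I → ℕ} (w : Word α) : Prop :=
  ∀ r s : Fin (height α), r < s → w r = w s →
    ∃ t u : Fin (height α), r < t ∧ t < u ∧ u < s ∧ Q.Nbr (w r) (w t) ∧ Q.Nbr (w r) (w u)

/-- Homogeneous components: the connected components of the weight graph all of whose words are
homogeneous. -/
def HomogeneousComponent (Q : SimpleQuiver I) (α : I → ℕ) : Type _ :=
  {C : (weightGraph Q α).ConnectedComponent // ∀ w ∈ C.supp, IsHomogeneousWord Q w}


theorem swap_lt_swap {d k : ℕ} (hk : k + 1 < d) {a b : Fin d} (h : a < b)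
    (h' : ¬ (a = lo hk ∧ b = hi hk)) :
    Equiv.swap (lo hk) (hi hk) a < Equiv.swap (lo hk) (hi hk) b := by
  simp only [Equiv.swap_apply_def]
  simp only [lo, hi, Fin.ext_iff, Fin.lt_def] at *
  split_ifs <;> simp_all <;> omega

theorem IsHomogeneousWord.swap {Q : SimpleQuiver I} {α : I → ℕ} {w : Word α}
    (hw : IsHomogeneousWord Q w) {k : ℕ} {hk : k + 1 < height α} (h : Admissible Q w k hk) :
    IsHomogeneousWord Q (w.swap k hk) := by
  intro r s hrs hwrs
  simp only [Word.swap_apply] at hwrs ⊢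
  have key : ∀ a b : Fin (height α), a < b → (w a = w b ∨ Q.Nbr (w a) (w b)) →
      Equiv.swap (lo hk) (hi hk) a < Equiv.swap (lo hk) (hi hk) b := by
    intro a b hab hw'
    apply swap_lt_swap hk hab
    rintro ⟨rfl, rfl⟩
    exact hw'.elim h.1 h.2
  have hrs' : Equiv.swap (lo hk) (hi hk) r < Equiv.swap (lo hk) (hi hk) s := by
    apply swap_lt_swap hk hrs
    rintro ⟨rfl, rfl⟩
    simp at hwrs
    exact h.1 hwrs.symm
  obtain ⟨t, u, hrt, htu, hus, h1, h2⟩ := hw _ _ hrs' hwrs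
  have e1 := key _ _ hrt (Or.inr h1)
  have e2 := key _ _ (hrt.trans htu) (Or.inr h2)
  have e3 := key _ _ hus (Or.inr (by rw [← hwrs]; exact h2.symm))
  have e4 := key _ _ (htu.trans hus) (Or.inr (by rw [← hwrs]; exact h1.symm))
  simp only [Equiv.swap_apply_self] at e1 e2 e3 e4
  rcases lt_or_gt_of_ne (fun hh => htu.ne ((Equiv.swap (lo hk) (hi hk)).injective hh)) with hl | hl
  · exact ⟨_, _, e1, hl, e3, by simpa using h1, by simpa using h2⟩
  · exact ⟨_, _, e2, hl, e4, by simpa using h2, by simpa using h1⟩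

/-- The component of a homogeneous word is homogeneous. -/
theorem isHomogeneousWord_of_mem {Q : SimpleQuiver I} {α : I → ℕ} {w : Word α}
    (hw : IsHomogeneousWord Q w) :
    ∀ v ∈ ((weightGraph Q α).connectedComponentMk w).supp, IsHomogeneousWord Q v := by
  intro v hv
  have hreach : (weightGraph Q α).Reachable w v :=
    (SimpleGraph.ConnectedComponent.exact hv).symm
  obtain ⟨p⟩ := hreach
  clear hv
  induction p with
  | nil => exact hw
  | cons hadj _ ih =>
    obtain ⟨k, hk, h, rfl⟩ := hadj
    exact ih (hw.swap h)

/-- The homogeneous component of a homogeneous word. -/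
def HomogeneousComponent.ofWord (Q : SimpleQuiver I) {α : I → ℕ} (w : Word α)
    (hw : IsHomogeneousWord Q w) : HomogeneousComponent Q α :=
  ⟨(weightGraph Q α).connectedComponentMk w, isHomogeneousWord_of_mem hw⟩

/-- The pairs of positions `a < b` carrying the letters `i`, `j`. -/
def orderedPairs {α : I → ℕ} (i j : I) (w : Word α) :
    Finset (Fin (height α) × Fin (height α)) :=
  Finset.univ.filter fun p => p.1 < p.2 ∧ w p.1 = i ∧ w p.2 = j

theorem mem_orderedPairs {α : I → ℕ} {i j : I} {w : Word α} {a b : Fin (height α)} :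
    (a, b) ∈ orderedPairs i j w ↔ a < b ∧ w a = i ∧ w b = j := by
  simp only [orderedPairs, Finset.mem_filter, Finset.mem_univ, true_and]

theorem card_orderedPairs_swap_le {α : I → ℕ} {i j : I} {w : Word α} {k : ℕ}
    {hk : k + 1 < height α} (h : ¬ (w (lo hk) = i ∧ w (hi hk) = j)) :
    (orderedPairs i j w).card ≤ (orderedPairs i j (w.swap k hk)).card := by
  apply Finset.card_le_card_of_injOn
    (Prod.map (Equiv.swap (lo hk) (hi hk)) (Equiv.swap (lo hk) (hi hk)))
  · rintro ⟨a, b⟩ hab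
    rw [Finset.mem_coe, mem_orderedPairs] at hab
    rw [Finset.mem_coe, Prod.map_apply, mem_orderedPairs]
    simp only [Word.swap_apply, Equiv.swap_apply_self]
    refine ⟨swap_lt_swap hk hab.1 ?_, hab.2⟩
    rintro ⟨rfl, rfl⟩
    exact h hab.2
  · exact ((Equiv.injective _).prodMap (Equiv.injective _)).injOn

theorem card_orderedPairs_adj {Q : SimpleQuiver I} {α : I → ℕ} {i j : I} (hij : Q.Nbr i j)
    {w v : Word α} (h : (weightGraph Q α).Adj w v) :
    (orderedPairs i j w).card = (orderedPairs i j v).card := by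
  have key : ∀ w v : Word α, (weightGraph Q α).Adj w v →
      (orderedPairs i j w).card ≤ (orderedPairs i j v).card := by
    rintro w v ⟨k, hk, ha, rfl⟩
    apply card_orderedPairs_swap_le
    rintro ⟨rfl, rfl⟩
    exact ha.2 hij
  exact le_antisymm (key _ _ h) (key _ _ h.symm)

theorem card_orderedPairs_eq {Q : SimpleQuiver I} {α : I → ℕ} {i j : I} (hij : Q.Nbr i j)
    {w v : Word α} (h : (weightGraph Q α).Reachable w v) :
    (orderedPairs i j w).card = (orderedPairs i j v).card := by
  obtain ⟨p⟩ := h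
  induction p with
  | nil => rfl
  | cons hadj _ ih => rw [card_orderedPairs_adj hij hadj, ih]

/-- Inside a homogeneous component, `s_k w` stays in the component exactly if the transposition is
admissible. -/
theorem HomogeneousComponent.swap_mem_iff {Q : SimpleQuiver I} {α : I → ℕ}
    (C : HomogeneousComponent Q α) {w : Word α} (hw : w ∈ C.1.supp) (k : ℕ)
    (hk : k + 1 < height α) : w.swap k hk ∈ C.1.supp ↔ Admissible Q w k hk := by
  constructor
  · intro hs
    refine ⟨fun heq => ?_, fun hn => ?_⟩
    · obtain ⟨t, u, h1, h2, h3, -⟩ := C.2 w hw (lo hk) (hi hk) (by simp [lo, hi]) heq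
      simp only [lo, hi, Fin.lt_def] at h1 h2 h3
      omega
    · have hr : (weightGraph Q α).Reachable w (w.swap k hk) :=
        SimpleGraph.ConnectedComponent.exact
          (((SimpleGraph.ConnectedComponent.mem_supp_iff _ _).1 hw).trans
            ((SimpleGraph.ConnectedComponent.mem_supp_iff _ _).1 hs).symm)
      have e := card_orderedPairs_eq hn hr
      have hne : w (hi hk) ≠ w (lo hk) := by
        intro h
        rw [h] at hn
        exact Q.not_nbr_self _ hn
      have hle := Finset.card_le_card_of_injOn
        (s := orderedPairs (w (lo hk)) (w (hi hk)) (w.swap k hk))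
        (t := (orderedPairs (w (lo hk)) (w (hi hk)) w).erase (lo hk, hi hk))
        (Prod.map (Equiv.swap (lo hk) (hi hk)) (Equiv.swap (lo hk) (hi hk))) (by
          rintro ⟨a, b⟩ hab
          rw [Finset.mem_coe, mem_orderedPairs, Word.swap_apply, Word.swap_apply] at hab
          rw [Finset.mem_coe, Finset.mem_erase, Prod.map_apply, mem_orderedPairs]
          have hlt := swap_lt_swap hk hab.1 (by
            rintro ⟨rfl, rfl⟩
            simp at hab
            exact hne hab.2.1)
          refine ⟨fun hh => ?_, hlt, hab.2⟩
          simp only [Prod.mk.injEq] at hh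
          have h1 := hh.1
          have h2 := hh.2
          rw [Equiv.swap_apply_eq_iff] at h1 h2
          simp at h1 h2
          subst h1 h2
          have := hab.1
          simp [lo, hi] at this)
        ((Equiv.injective _).prodMap (Equiv.injective _)).injOn
      have hmem : (lo hk, hi hk) ∈ orderedPairs (w (lo hk)) (w (hi hk)) w := by
        rw [mem_orderedPairs]
        simp [lo, hi]
      rw [← e] at hle
      have := Finset.card_erase_lt_of_mem hmem
      omega
  · intro ha
    rw [SimpleGraph.ConnectedComponent.mem_supp_iff] at hw ⊢
    rw [← hw]
    exact SimpleGraph.ConnectedComponent.sound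
      (SimpleGraph.Adj.reachable (⟨k, hk, ha, rfl⟩ : (weightGraph Q α).Adj _ _)).symm

theorem HomogeneousComponent.ne {Q : SimpleQuiver I} {α : I → ℕ}
    (C : HomogeneousComponent Q α) {w : Word α} (hw : w ∈ C.1.supp) (k : ℕ)
    (hk : k + 1 < height α) : w (lo hk) ≠ w (hi hk) := by
  intro heq
  obtain ⟨t, u, h1, h2, h3, -⟩ := C.2 w hw (lo hk) (hi hk) (by simp [lo, hi]) heq
  simp only [lo, hi, Fin.lt_def] at h1 h2 h3
  omega

theorem HomogeneousComponent.ne' {Q : SimpleQuiver I} {α : I → ℕ}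
    (C : HomogeneousComponent Q α) {w : Word α} (hw : w ∈ C.1.supp) (k : ℕ)
    (hk : k + 1 < height α) (hk' : k + 1 + 1 < height α) : w (lo hk) ≠ w (hi hk') := by
  intro heq
  obtain ⟨t, u, h1, h2, h3, -⟩ := C.2 w hw (lo hk) (hi hk') (by simp [lo, hi]) heq
  simp only [lo, hi, Fin.lt_def] at h1 h2 h3
  omega

/-! ### The homogeneous modules -/

/-- The vector space `S(C)` with basis `v_w`, `w ∈ C`. -/
def HomogeneousModule (F : Type*) [Field F] {Q : SimpleQuiver I} {α : I → ℕ}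
    (C : HomogeneousComponent Q α) : Type _ := {w : Word α // w ∈ C.1.supp} →₀ F

variable (F)

instance {Q : SimpleQuiver I} {α : I → ℕ} (C : HomogeneousComponent Q α) :
    AddCommGroup (HomogeneousModule F C) :=
  inferInstanceAs (AddCommGroup ({w : Word α // w ∈ C.1.supp} →₀ F))

instance {Q : SimpleQuiver I} {α : I → ℕ} (C : HomogeneousComponent Q α) :
    Module F (HomogeneousModule F C) :=
  inferInstanceAs (Module F ({w : Word α // w ∈ C.1.supp} →₀ F))

namespace HomogeneousModule

variable {Q : SimpleQuiver I} {α : I → ℕ} (C : HomogeneousComponent Q α)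

/-- The basis `v_w`, `w ∈ C`, of `S(C)`. -/
def basis : Module.Basis {w : Word α // w ∈ C.1.supp} F (HomogeneousModule F C) :=
  Finsupp.basisSingleOne

open scoped Classical in
/-- The operators by which the generators of `R_α` act on `S(C)`. -/
def genAction : KLRGen α → Module.End F (HomogeneousModule F C)
  | .e w' => (basis F C).constr F fun w => if w' = w.1 then basis F C w else 0
  | .y _ => 0
  | .psi k hk => (basis F C).constr F fun w =>
      if h : w.1.swap k hk ∈ C.1.supp then basis F C ⟨w.1.swap k hk, h⟩ else 0

open scoped Classical in
theorem genAction_e (w' : Word α) (w : {w : Word α // w ∈ C.1.supp}) :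
    genAction F C (.e w') (basis F C w) = if w' = w.1 then basis F C w else 0 :=
  (basis F C).constr_basis F _ w

open scoped Classical in
theorem genAction_psi (k : ℕ) (hk : k + 1 < height α) (w : {w : Word α // w ∈ C.1.supp}) :
    genAction F C (.psi k hk) (basis F C w) =
      if h : w.1.swap k hk ∈ C.1.supp then basis F C ⟨w.1.swap k hk, h⟩ else 0 :=
  (basis F C).constr_basis F _ w

theorem genAction_y (k : Fin (height α)) : genAction F C (.y k) = 0 := rfl

open scoped Classical in
/-- `v_u` if `u ∈ C`, and zero otherwise. -/
def vec (u : Word α) : HomogeneousModule F C :=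
  if h : u ∈ C.1.supp then basis F C ⟨u, h⟩ else 0

open scoped Classical in
theorem e_vec (w u : Word α) :
    genAction F C (.e w) (vec F C u) = if w = u then vec F C u else 0 := by
  unfold vec
  split_ifs with h1 h2 h2 <;> simp [genAction_e, *]

open scoped Classical in
theorem psi_vec (k : ℕ) (hk : k + 1 < height α) {u : Word α} (hu : u ∈ C.1.supp) :
    genAction F C (.psi k hk) (vec F C u) =
      if Admissible Q u k hk then vec F C (u.swap k hk) else 0 := by
  have h := C.swap_mem_iff hu k hk
  simp only [← h]
  unfold vec
  rw [dif_pos hu, genAction_psi]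
  split_ifs <;> rfl

theorem ext_vec {f g : Module.End F (HomogeneousModule F C)}
    (h : ∀ u ∈ C.1.supp, f (vec F C u) = g (vec F C u)) : f = g := by
  refine (basis F C).ext fun w => ?_
  have := h w.1 w.2
  rwa [vec, dif_pos w.2] at this

theorem admissible_swap_of_far {w : Word α} {k l : ℕ} (hk : k + 1 < height α)
    (hl : l + 1 < height α) (h : k + 1 < l ∨ l + 1 < k) :
    Admissible Q (w.swap l hl) k hk ↔ Admissible Q w k hk := by
  have h1 : Equiv.swap (lo hl) (hi hl) (lo hk) = lo hk := by
    apply Equiv.swap_apply_of_ne_of_ne <;> simp [lo, hi] <;> omega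
  have h2 : Equiv.swap (lo hl) (hi hl) (hi hk) = hi hk := by
    apply Equiv.swap_apply_of_ne_of_ne <;> simp [lo, hi] <;> omega
  simp only [Admissible, Word.swap_apply, h1, h2]

theorem swap_comm_of_far (w : Word α) {k l : ℕ} (hk : k + 1 < height α)
    (hl : l + 1 < height α) (h : k + 1 < l ∨ l + 1 < k) :
    (w.swap l hl).swap k hk = (w.swap k hk).swap l hl := by
  apply Subtype.ext
  funext r
  change w (Equiv.swap (lo hl) (hi hl) (Equiv.swap (lo hk) (hi hk) r)) =
    w (Equiv.swap (lo hk) (hi hk) (Equiv.swap (lo hl) (hi hl) r))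
  simp only [Equiv.swap_apply_def, lo, hi]
  grind

theorem swap_braid (w : Word α) {k : ℕ} (hk : k + 1 < height α) (hk' : k + 1 + 1 < height α) :
    ((w.swap (k + 1) hk').swap k hk).swap (k + 1) hk' =
      ((w.swap k hk).swap (k + 1) hk').swap k hk := by
  apply Subtype.ext
  funext r
  simp only [Word.swap_apply]
  simp only [Equiv.swap_apply_def, lo, hi]
  grind

theorem genAction_rel {a b : FreeAlgebra F (KLRGen α)} (h : KLRRel F Q α a b) :
    FreeAlgebra.lift F (genAction F C) a = FreeAlgebra.lift F (genAction F C) b := by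
  classical
  apply ext_vec
  intro u hu
  cases h with
  | e_e w v =>
    by_cases h1 : w = v <;> by_cases h2 : v = u <;> simp_all [e_vec]
  | sum_e =>
    simp [e_vec]
  | y_e k w => simp [genAction_y]
  | psi_e k hk w =>
    simp only [map_mul, FreeAlgebra.lift_ι_apply, Module.End.mul_apply, e_vec, psi_vec F C k hk hu]
    by_cases h1 : w = u
    · subst h1
      simp only [if_true, psi_vec F C k hk hu]
      split_ifs <;> simp [e_vec]
    · have h2 : w.swap k hk ≠ u.swap k hk := fun h =>
        h1 (by rw [← Word.swap_swap k hk w, h, Word.swap_swap])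
      split_ifs <;> simp [e_vec, h2]
  | y_y k l => simp [genAction_y]
  | y_psi k l hl h h' => simp [genAction_y]
  | y_psi_left k hk w =>
    by_cases h1 : w = u
    · subst h1
      simp [genAction_y, C.ne hu k hk]
    · split_ifs <;> simp [genAction_y, e_vec, h1]
  | psi_y_left k hk w =>
    by_cases h1 : w = u
    · subst h1
      simp [genAction_y, C.ne hu k hk]
    · split_ifs <;> simp [genAction_y, e_vec, h1]
  | psi_sq k hk w =>
    by_cases h1 : w = u
    · subst h1
      by_cases ha : Admissible Q w k hk
      · have hs := (C.swap_mem_iff hu k hk).2 ha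
        have n1 : ¬ Q.arr (w (lo hk)) (w (hi hk)) := fun h => ha.2 (Or.inl h)
        have n2 : ¬ Q.arr (w (hi hk)) (w (lo hk)) := fun h => ha.2 (Or.inr h)
        simp only [C.ne hu k hk, n1, n2, if_false, map_mul, FreeAlgebra.lift_ι_apply,
          Module.End.mul_apply, e_vec, if_true, psi_vec F C k hk hu, ha, psi_vec F C k hk hs,
          ha.swap, Word.swap_swap]
      · have hn : Q.arr (w (lo hk)) (w (hi hk)) ∨ Q.arr (w (hi hk)) (w (lo hk)) := by
          by_contra hn
          exact ha ⟨C.ne hu k hk, hn⟩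
        rw [if_neg (C.ne hu k hk)]
        have hz : (FreeAlgebra.lift F (genAction F C))
            (genPsi F k hk * genPsi F k hk * genE F w) (vec F C w) = 0 := by
          simp [e_vec, psi_vec F C k hk hu, ha]
        rw [hz]
        split_ifs with h1 h2
        · simp [genAction_y]
        · simp [genAction_y]
        · exact absurd hn (by tauto)
    · split_ifs <;> simp [genAction_y, e_vec, h1]
  | psi_psi k l hk hl h =>
    have e1 := admissible_swap_of_far (Q := Q) (w := u) hk hl h
    have e2 := admissible_swap_of_far (Q := Q) (w := u) hl hk h.symm
    simp only [map_mul, FreeAlgebra.lift_ι_apply, Module.End.mul_apply, psi_vec F C k hk hu,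
      psi_vec F C l hl hu]
    by_cases hak : Admissible Q u k hk <;> by_cases hal : Admissible Q u l hl
    · have hsk := (C.swap_mem_iff hu k hk).2 hak
      have hsl := (C.swap_mem_iff hu l hl).2 hal
      simp [hak, hal, psi_vec F C k hk hsl, psi_vec F C l hl hsk, e1, e2,
        swap_comm_of_far u hk hl h]
    · have hsk := (C.swap_mem_iff hu k hk).2 hak
      simp [hak, hal, psi_vec F C l hl hsk, e2]
    · have hsl := (C.swap_mem_iff hu l hl).2 hal
      simp [hak, hal, psi_vec F C k hk hsl, e1]
    · simp [hak, hal]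
  | braid k hk hk' w =>
    by_cases h1 : w = u
    · subst h1
      have hne := (C.ne' hu k hk hk').symm
      simp only [hne, false_and, if_false]
      simp only [map_mul, map_sub, map_zero, FreeAlgebra.lift_ι_apply, Module.End.mul_apply,
        e_vec, if_true, LinearMap.sub_apply, LinearMap.zero_apply]
      rw [sub_eq_zero]
      have hlo : lo hk' = hi hk := rfl
      have m1 : lo hk ≠ hi hk := by simp [lo, hi]
      have m2 : hi hk ≠ hi hk' := by simp [hi]
      have m3 : lo hk ≠ hi hk' := by
        simp [lo, hi]
        omega
      have p1 : Equiv.swap (lo hk) (hi hk) (hi hk') = hi hk' :=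
        Equiv.swap_apply_of_ne_of_ne m3.symm m2.symm
      have p2 : Equiv.swap (hi hk) (hi hk') (lo hk) = lo hk :=
        Equiv.swap_apply_of_ne_of_ne m1 m3
      have a1 : Admissible Q ((w.swap k hk).swap (k + 1) hk') k hk ↔
          Admissible Q w (k + 1) hk' := by
        simp [Admissible, hlo, p1, p2]
      have a2 : Admissible Q ((w.swap (k + 1) hk').swap k hk) (k + 1) hk' ↔
          Admissible Q w k hk := by
        simp [Admissible, hlo, p1, p2]
      have a3 : Admissible Q (w.swap k hk) (k + 1) hk' ↔
          Admissible Q (w.swap (k + 1) hk') k hk := by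
        simp [Admissible, hlo, p1, p2]
      have mem := fun (v : Word α) (hv : v ∈ C.1.supp) (j : ℕ) (hj : j + 1 < height α)
        (ha : Admissible Q v j hj) => (C.swap_mem_iff hv j hj).2 ha
      rw [psi_vec F C k hk hu, psi_vec F C (k + 1) hk' hu]
      by_cases b1 : Admissible Q w k hk <;> by_cases b2 : Admissible Q w (k + 1) hk' <;>
        by_cases b3 : Admissible Q (w.swap (k + 1) hk') k hk
      · have c1 := mem _ hu _ _ b1
        have c2 := mem _ hu _ _ b2
        rw [if_pos b1, if_pos b2, psi_vec F C _ _ c1, psi_vec F C _ _ c2, if_pos b3,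
          if_pos (a3.2 b3), psi_vec F C _ _ (mem _ c1 _ _ (a3.2 b3)),
          psi_vec F C _ _ (mem _ c2 _ _ b3), if_pos (a1.2 b2), if_pos (a2.2 b1), swap_braid]
      · have c1 := mem _ hu _ _ b1
        have c2 := mem _ hu _ _ b2
        rw [if_pos b1, if_pos b2, psi_vec F C _ _ c1, psi_vec F C _ _ c2, if_neg b3,
          if_neg (fun h => b3 (a3.1 h))]
        simp
      · have c1 := mem _ hu _ _ b1
        rw [if_pos b1, if_neg b2, psi_vec F C _ _ c1, if_pos (a3.2 b3),
          psi_vec F C _ _ (mem _ c1 _ _ (a3.2 b3)), if_neg (fun h => b2 (a1.1 h))]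
        simp
      · have c1 := mem _ hu _ _ b1
        rw [if_pos b1, if_neg b2, psi_vec F C _ _ c1, if_neg (fun h => b3 (a3.1 h))]
        simp
      · have c2 := mem _ hu _ _ b2
        rw [if_neg b1, if_pos b2, psi_vec F C _ _ c2, if_pos b3,
          psi_vec F C _ _ (mem _ c2 _ _ b3), if_neg (fun h => b1 (a2.1 h))]
        simp
      · have c2 := mem _ hu _ _ b2
        rw [if_neg b1, if_pos b2, psi_vec F C _ _ c2, if_neg b3]
        simp
      · rw [if_neg b1, if_neg b2]
        simp
      · rw [if_neg b1, if_neg b2]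
        simp
    · split_ifs <;> simp [e_vec, h1]

/-- The representation of `R_α` on `S(C)`. -/
def rep : KLRAlgebra F Q α →ₐ[F] Module.End F (HomogeneousModule F C) :=
  RingQuot.liftAlgHom F ⟨FreeAlgebra.lift F (genAction F C), fun _ _ h => genAction_rel F C h⟩

/-- The `R_α`-module structure of `S(C)`. -/
instance : Module (KLRAlgebra F Q α) (HomogeneousModule F C) :=
  Module.compHom _ (rep F C).toRingHom

instance : IsScalarTower F (KLRAlgebra F Q α) (HomogeneousModule F C) where
  smul_assoc c a v := by
    change rep F C (c • a) v = c • rep F C a v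
    rw [map_smul, LinearMap.smul_apply]

end HomogeneousModule

/-- The content of a list of letters. -/
def content (L : List I) : I → ℕ := fun i => L.count i

theorem height_content (L : List I) : height (content L) = L.length := by
  simpa [height, content] using Multiset.sum_count_eq_card (s := Finset.univ) (m := (L : Multiset I))
    (fun _ _ => Finset.mem_univ _)

/-- A list of letters as a word. -/
def Word.ofList (L : List I) : Word (content L) :=
  ⟨fun r => L.get (r.cast (height_content L)), fun i => by
    have h1 : (Finset.univ.filter fun r : Fin (height (content L)) =>
        L.get (r.cast (height_content L)) = i).card =
        (Finset.univ.filter fun r : Fin L.length => L.get r = i).card :=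
      Finset.card_equiv (finCongr (height_content L)) (by simp)
    have h2 : (Finset.univ : Finset (Fin L.length)).val.map L.get = (L : Multiset I) := by
      rw [Fin.univ_val_map, List.ofFn_get]
    rw [h1, content, ← Multiset.coe_count, ← h2, Multiset.count_map]
    simp only [eq_comm]
    rfl⟩

end Words

/-! ### Dyck paths -/

/-- The height (second coordinate) of the point of the path `D` with first coordinate `s`. -/
def pathHeight (D : DyckWord) (s : ℕ) : ℕ :=
  (D.toList.take s).count DyckStep.U - (D.toList.take s).count DyckStep.D

/-- The rise in position `t` (from the point with first coordinate `t`) is followed by a fall. -/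
def IsPeakPosition (D : DyckWord) (t : ℕ) : Prop :=
  D.toList[t]? = some DyckStep.U ∧ D.toList[t + 1]? = some DyckStep.D

instance (D : DyckWord) (t : ℕ) : Decidable (IsPeakPosition D t) :=
  inferInstanceAs (Decidable (_ ∧ _))

/-- The summits `(x, y)` of the peaks of `D`, from left to right. -/
def peaks (D : DyckWord) : List (ℕ × ℕ) :=
  ((List.range D.toList.length).filter fun t => IsPeakPosition D t).map
    fun t => (t + 1, pathHeight D (t + 1))

/-- The steps in the positions `s, …, s + l - 1` form an ascent of `D` (a maximal run of `l`
rises), beginning at the point with first coordinate `s`. -/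
def IsAscent (D : DyckWord) (s l : ℕ) : Prop :=
  1 ≤ l ∧ (∀ r < l, D.toList[s + r]? = some DyckStep.U) ∧
    (s = 0 ∨ D.toList[s - 1]? = some DyckStep.D) ∧ D.toList[s + l]? ≠ some DyckStep.U

/-- The number `k`: the sum of the peak heights minus the number of peaks (every peak has height at
least one, so the subtraction does not truncate). -/
def dyckDegree (D : DyckWord) : ℕ := ((peaks D).map Prod.snd).sum - (peaks D).length

/-- The decreasing segment `T_i^j = [j, j - 1, …, i]`, empty if `i > j`; the letter `a` is the
element of `Fin n` with value `a - 1`. -/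
def segment (n i j : ℕ) : List (Fin n) :=
  ((List.finRange n).filter fun a => i ≤ a.val + 1 ∧ a.val + 1 ≤ j).reverse

/-- In the triangular lattice, the block `T_i^j` (`i ≤ j`) is the unit diamond with summit
`(i + j, j - i + 2)`; the bottom triangles, with summit `(2i - 1, 1)`, fit this for `j = i - 1`.
This is the lower index `i` of the block with summit `q`. -/
def lowerIndex (q : ℕ × ℕ) : ℕ := (q.1 - q.2) / 2 + 1

/-- The upper index `j` of the block `T_i^j` with summit `q`. -/
def upperIndex (q : ℕ × ℕ) : ℕ := (q.1 + q.2) / 2 - 1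

/-- The word read off the blocks at the peaks of `D` from left to right (bottom triangles contribute
empty segments). -/
def peakWord (n : ℕ) (D : DyckWord) : List (Fin n) :=
  (peaks D).flatMap fun q => segment n (lowerIndex q) (upperIndex q)

theorem mem_segment {n i j : ℕ} {a : Fin n} :
    a ∈ segment n i j ↔ i ≤ a.val + 1 ∧ a.val + 1 ≤ j := by
  simp [segment]

theorem segment_pairwise (n i j : ℕ) : (segment n i j).Pairwise (fun a b => b < a) := by
  rw [segment, List.pairwise_reverse]
  exact (List.pairwise_lt_finRange n).filter _

theorem segment_index_lt {n i j r s : ℕ} {a b : Fin n} (hr : (segment n i j)[r]? = some a)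
    (hs : (segment n i j)[s]? = some b) (h : b < a) : r < s := by
  obtain ⟨hr1, hr2⟩ := List.getElem?_eq_some_iff.1 hr
  obtain ⟨hs1, hs2⟩ := List.getElem?_eq_some_iff.1 hs
  by_contra hlt
  rcases Nat.lt_or_eq_of_le (not_lt.1 hlt) with h' | h'
  · have := List.pairwise_iff_getElem.1 (segment_pairwise n i j) s r hs1 hr1 h'
    rw [hr2, hs2] at this
    exact absurd h (not_lt.2 this.le)
  · subst h'
    rw [hr2] at hs2
    exact absurd h (by simp [hs2])

theorem exists_succ_before {n : ℕ} {a b : Fin n} (hb : b.val = a.val + 1) (qs : List (ℕ × ℕ))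
    (hq : ∀ q ∈ qs, a.val + 1 < q.2) (s : ℕ)
    (hs : (qs.flatMap fun q => segment n q.1 q.2)[s]? = some a) :
    ∃ u < s, (qs.flatMap fun q => segment n q.1 q.2)[u]? = some b := by
  induction qs generalizing s with
  | nil => simp at hs
  | cons q qs ih =>
    rw [List.flatMap_cons] at hs ⊢
    by_cases hlen : s < (segment n q.1 q.2).length
    · rw [List.getElem?_append_left hlen] at hs
      have ha := mem_segment.1 (List.mem_of_getElem? hs)
      have h2 := hq q (by simp)
      have hbm : b ∈ segment n q.1 q.2 := mem_segment.2 ⟨by omega, by omega⟩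
      obtain ⟨u, hu⟩ := List.mem_iff_getElem?.1 hbm
      have hus := segment_index_lt hu hs (by rw [Fin.lt_def]; omega)
      exact ⟨u, hus, by rwa [List.getElem?_append_left (hus.trans hlen)]⟩
    · rw [List.getElem?_append_right (not_lt.1 hlen)] at hs
      obtain ⟨u, hu, hu'⟩ := ih (fun q' h' => hq q' (by simp [h'])) _ hs
      refine ⟨(segment n q.1 q.2).length + u, by omega, ?_⟩
      rw [List.getElem?_append_right (by omega)]
      simpa using hu'

theorem segments_homogeneous {n : ℕ} (qs : List (ℕ × ℕ))
    (hp : qs.Pairwise fun q q' => q.1 < q'.1 ∧ q.2 < q'.2) (hn : ∀ q ∈ qs, 1 ≤ q.1 ∧ q.2 ≤ n)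
    (r s : ℕ) (a : Fin n) (hrs : r < s)
    (hr : (qs.flatMap fun q => segment n q.1 q.2)[r]? = some a)
    (hs : (qs.flatMap fun q => segment n q.1 q.2)[s]? = some a) :
    ∃ (t u : ℕ) (b c : Fin n), r < t ∧ t < u ∧ u < s ∧
      (qs.flatMap fun q => segment n q.1 q.2)[t]? = some b ∧
      (qs.flatMap fun q => segment n q.1 q.2)[u]? = some c ∧
      b.val + 1 = a.val ∧ a.val + 1 = c.val := by
  induction qs generalizing r s with
  | nil => simp at hs
  | cons q qs ih =>
    rw [List.pairwise_cons] at hp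
    rw [List.flatMap_cons] at hr hs ⊢
    by_cases hl : s < (segment n q.1 q.2).length
    · rw [List.getElem?_append_left hl] at hs
      rw [List.getElem?_append_left (hrs.trans hl)] at hr
      obtain ⟨hr1, hr2⟩ := List.getElem?_eq_some_iff.1 hr
      obtain ⟨hs1, hs2⟩ := List.getElem?_eq_some_iff.1 hs
      have := List.pairwise_iff_getElem.1 (segment_pairwise n q.1 q.2) r s hr1 hs1 hrs
      rw [hr2, hs2] at this
      exact absurd this (lt_irrefl _)
    · rw [List.getElem?_append_right (not_lt.1 hl)] at hs
      by_cases hl' : r < (segment n q.1 q.2).length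
      · rw [List.getElem?_append_left hl'] at hr
        have ha := mem_segment.1 (List.mem_of_getElem? hr)
        obtain ⟨q', hq', ha'⟩ := List.mem_flatMap.1 (List.mem_of_getElem? hs)
        have ha'' := mem_segment.1 ha'
        have hlt := hp.1 q' hq'
        have h1 := (hn q (by simp)).1
        have h2 := (hn q' (by simp [hq'])).2
        have hbm : (⟨a.val - 1, by omega⟩ : Fin n) ∈ segment n q.1 q.2 :=
          mem_segment.2 ⟨by simp; omega, by simp; omega⟩
        obtain ⟨t, ht⟩ := List.mem_iff_getElem?.1 hbm
        have hrt := segment_index_lt hr ht (by rw [Fin.lt_def]; simp; omega)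
        have htl := (List.getElem?_eq_some_iff.1 ht).1
        obtain ⟨u, hu, hu'⟩ := exists_succ_before (b := ⟨a.val + 1, by omega⟩) rfl qs
          (fun q'' h'' => by have := hp.1 q'' h''; omega) _ hs
        refine ⟨t, (segment n q.1 q.2).length + u, _, ⟨a.val + 1, by omega⟩, hrt, by omega, by omega,
          by rw [List.getElem?_append_left htl]; exact ht, ?_, by simp; omega, rfl⟩
        rw [List.getElem?_append_right (by omega)]
        simpa using hu'
      · rw [List.getElem?_append_right (not_lt.1 hl')] at hr
        obtain ⟨t, u, b, c, h1, h2, h3, h4, h5, h6⟩ := ih hp.2 (fun q' h' => hn q' (by simp [h']))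
          _ _ (by omega) hr hs
        refine ⟨(segment n q.1 q.2).length + t, (segment n q.1 q.2).length + u, b, c, by omega,
          by omega, by omega, ?_, ?_, h6⟩
        · rw [List.getElem?_append_right (by omega)]
          simpa using h4
        · rw [List.getElem?_append_right (by omega)]
          simpa using h5

theorem lowerIndex_peak (D : DyckWord) (t : ℕ) (ht : t ≤ D.toList.length) :
    lowerIndex (t, pathHeight D t) = (D.toList.take t).count DyckStep.D + 1 ∧
      upperIndex (t, pathHeight D t) = (D.toList.take t).count DyckStep.U - 1 := by
  have h1 := D.count_D_le_count_U t
  have h2 : (D.toList.take t).count DyckStep.U + (D.toList.take t).count DyckStep.D = t := by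
    have h3 : ∀ L : List DyckStep, L.count DyckStep.U + L.count DyckStep.D = L.length := by
      intro L
      induction L with
      | nil => rfl
      | cons a L ih => cases a <;> simp [← ih] <;> omega
    rw [h3, List.length_take, min_eq_left ht]
  simp only [lowerIndex, upperIndex, pathHeight]
  omega

theorem count_take_lt {L : List DyckStep} {a : DyckStep} {s t r : ℕ}
    (hsr : s ≤ r) (hrt : r < t) (h : L[r]? = some a) : (L.take s).count a < (L.take t).count a := by
  have h1 : (L.take s).count a ≤ (L.take r).count a :=
    (List.take_sublist_take_left hsr).count_le _
  have h2 : (L.take (r + 1)).count a ≤ (L.take t).count a :=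
    (List.take_sublist_take_left (by omega)).count_le _
  have h3 : (L.take (r + 1)).count a = (L.take r).count a + 1 := by
    rw [List.take_add_one, h]
    simp
  omega

theorem peakWord_homogeneous {n : ℕ} (D : DyckWord) (hD : D.semilength = n + 1) (r s : ℕ)
    (a : Fin n) (hrs : r < s) (hr : (peakWord n D)[r]? = some a)
    (hs : (peakWord n D)[s]? = some a) :
    ∃ (t u : ℕ) (b c : Fin n), r < t ∧ t < u ∧ u < s ∧
      (peakWord n D)[t]? = some b ∧ (peakWord n D)[u]? = some c ∧
      b.val + 1 = a.val ∧ a.val + 1 = c.val := by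
  have e : peakWord n D = ((peaks D).map fun q => (lowerIndex q, upperIndex q)).flatMap
      fun q => segment n q.1 q.2 := by
    rw [List.flatMap_map]
    rfl
  rw [e] at hr hs ⊢
  refine segments_homogeneous _ ?_ ?_ r s a hrs hr hs
  · rw [peaks, List.map_map, List.pairwise_map]
    refine (List.pairwise_lt_range.filter _).imp_of_mem ?_
    intro t t' ht ht' hlt
    simp only [List.mem_filter, List.mem_range, decide_eq_true_eq] at ht ht'
    have i1 := lowerIndex_peak D (t + 1) (by omega)
    have i2 := lowerIndex_peak D (t' + 1) (by omega)
    have c1 := count_take_lt (s := t + 1) (t := t' + 1) le_rfl (by omega) ht.2.2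
    have c2 := count_take_lt (s := t + 1) (t := t' + 1) (r := t') (by omega) (by omega)
      ht'.2.1
    have c3 := count_take_lt (s := 0) (t := t + 1) (r := t) (by omega) (by omega)
      ht.2.1
    simp only [Function.comp_apply, i1.1, i1.2, i2.1, i2.2]
    omega
  · intro q hq
    simp only [peaks, List.map_map, List.mem_map, List.mem_filter, List.mem_range,
      Function.comp_apply] at hq
    obtain ⟨t, ⟨ht, -⟩, rfl⟩ := hq
    have i1 := lowerIndex_peak D (t + 1) (by omega)
    have c : (D.toList.take (t + 1)).count DyckStep.U ≤ n + 1 := by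
      rw [← hD]
      exact (List.take_sublist _ _).count_le _
    simp only [i1.1, i1.2]
    omega

theorem isHomogeneousWord_peakWord {n : ℕ} {Q : SimpleQuiver (Fin n)} (hQ : Q.IsTypeA)
    (D : DyckWord) (hD : D.semilength = n + 1) :
    IsHomogeneousWord Q (Word.ofList (peakWord n D)) := by
  intro r s hrs h
  have hlen := height_content (peakWord n D)
  have get : ∀ (t : ℕ) (b : Fin n) (ht : (peakWord n D)[t]? = some b),
      ∃ h : t < height (content (peakWord n D)), (Word.ofList (peakWord n D)) ⟨t, h⟩ = b := by
    intro t b ht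
    obtain ⟨h1, h2⟩ := List.getElem?_eq_some_iff.1 ht
    exact ⟨by omega, h2⟩
  have get' : ∀ t : Fin (height (content (peakWord n D))),
      (peakWord n D)[t.val]? = some (Word.ofList (peakWord n D) t) := by
    intro t
    exact List.getElem?_eq_some_iff.2 ⟨by omega, rfl⟩
  obtain ⟨t, u, b, c, h1, h2, h3, h4, h5, h6, h7⟩ := peakWord_homogeneous D hD r s _ hrs
    (get' r) (by rw [h]; exact get' s)
  obtain ⟨ht, rfl⟩ := get t b h4
  obtain ⟨hu, rfl⟩ := get u c h5
  exact ⟨⟨t, ht⟩, ⟨u, hu⟩, h1, h2, h3, (hQ _ _).2 (Or.inr h6), (hQ _ _).2 (Or.inl h7)⟩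

/-- The homogeneous component `Ψ(D)`, for a Dyck path `D` of semi-length `n + 1` and a quiver of
type `A_n`: the component of the word read off the peaks of `D`. -/
def dyckComponent {n : ℕ} (Q : SimpleQuiver (Fin n)) (hQ : Q.IsTypeA) (D : DyckWord)
    (hD : D.semilength = n + 1) : HomogeneousComponent Q (content (peakWord n D)) :=
  HomogeneousComponent.ofWord Q (Word.ofList (peakWord n D)) (isHomogeneousWord_peakWord hQ D hD)

/-! ### Extended ascents and the numbers `p_D(i, j)` -/

/-- The point `(x, y)` lies on an extended ascent of `D`, that is, on the segment of slope one from
the `x`-axis to the summit of a peak of `D`. -/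
def OnExtendedAscent (D : DyckWord) (x y : ℕ) : Prop :=
  ∃ q ∈ peaks D, y ≤ q.2 ∧ q.1 + y = x + q.2

instance (D : DyckWord) (x y : ℕ) : Decidable (OnExtendedAscent D x y) :=
  inferInstanceAs (Decidable (∃ q ∈ peaks D, _))

/-- The blocks `T_i^j`, `1 ≤ i ≤ j ≤ n`, on the extended ascents of `D`: those whose summit
`(i + j, j - i + 2)` (equivalently, whose upper left edge) lies on an extended ascent. -/
def ascentBlocks (n : ℕ) (D : DyckWord) : Finset (ℕ × ℕ) :=
  (Finset.Icc 1 n ×ˢ Finset.Icc 1 n).filter fun b =>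
    b.1 ≤ b.2 ∧ OnExtendedAscent D (b.1 + b.2) (b.2 - b.1 + 2)

/-- The part of `P_D(i, j)` after its first peak, starting at a point `(x, y)`: descend until the
path hits another extended ascent or returns to the `x`-axis, in the first case take one step up
and descend again, in the second case stop. The first argument bounds the number of falls. -/
def descend (D : DyckWord) : ℕ → ℕ → ℕ → List DyckStep
  | 0, _, _ => []
  | _ + 1, _, 0 => []
  | f + 1, x, y + 1 =>
    DyckStep.D ::
      if 0 < y ∧ OnExtendedAscent D (x + 1) y then DyckStep.U :: descend D f (x + 2) (y + 1)
      else descend D f (x + 1) y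

/-- The subpath `P_D(i, j)`: from the `x`-axis up to the summit of the block `T_i^j`, then as in
`descend`. (The subpath stays weakly below `D`, so that it has fewer falls than `D` has
steps and the bound on the number of falls is never reached.) -/
def subpath (D : DyckWord) (i j : ℕ) : List DyckStep :=
  List.replicate (j - i + 2) DyckStep.U ++ descend D D.toList.length (i + j) (j - i + 2)

/-- `p_D(i, j)`: the number of steps in the ascents of `P_D(i, j)`, minus one. -/
def pNumber (D : DyckWord) (i j : ℕ) : ℕ := (subpath D i j).count DyckStep.U - 1

end
end KLRDyck

namespace KLRDyck

/-! ### Commutation classes of lists -/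

section Traces

variable {I : Type*}

/-! The dimension is the number of words in the component, that is, the size of the commutation
class of the peak word (`finrank_homogeneousModule`, `card_supp`). Let the row `r` consist of the
letters `i_r, …, j_r` of the block at the `r`-th peak. Both ends increase strictly with `r`, and the
hypothesis on ascents gives the alternative `j_{r+1} = j_r + 1` or `j_r + 2 ≤ i_{r+1}`
(`isRowSystem_peaks`). In the first case the row `r + 1` sits left-justified below the row `r`; in
the second its letters commute with those of all earlier rows. The rows thus form a collection of
Young diagrams, and the class enumerates the ways to remove all boxes one at a time.

Indeed, in the reversed word a letter can be moved to the front exactly if it is the end `i_a` of a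
nonempty row with `i_a + 1 < i_{a+1}` (or of the last row), a corner. Splitting the class by its
first letter gives `f(λ) = ∑ f(λ - a)` over the corners `a` (`card_commClass_rowWord`).

With `H` the product of the hook lengths and `N` the number of boxes, `N!/H` satisfies the same
recursion if `∑ H(λ)/H(λ - a) = N`. In terms of the shifted lengths `L_r`, the identity `H · ∏ (i_b
- i_r) = ∏ L_r!` (`hookProd_mul_prod`), with `r < b` in the same diagram, turns the quotient into
`L_a ∏ (L_a - L_b - 1)/(L_a - L_b)`, over the other rows `b` of the diagram of `a`. This expression
vanishes on rows that are not corners, so the sum may run over all rows; it is then evaluated by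
Lagrange interpolation (`sum_mul_prod_sub_one_div`). The outcome is `card_commClass_mul_hookProd`.

Finally `p_D(i, j)` is a hook length (`pNumber_eq_hook`): the first ascent of the subpath gives the
box and its arm, plus one, and each later step up, taken at an extended ascent, is one row of the
leg (`count_descend`). -/

/-- Two lists differ by exchanging two consecutive letters related by `R`. -/
inductive CommStep (R : I → I → Prop) : List I → List I → Prop
  | swap {a b : I} (L : List I) (h : R a b) : CommStep R (a :: b :: L) (b :: a :: L)
  | cons (a : I) {L M : List I} (h : CommStep R L M) : CommStep R (a :: L) (a :: M)

/-- The equivalence relation on lists generated by commutations of letters related by `R`. -/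
abbrev CommEquiv (R : I → I → Prop) : List I → List I → Prop := Relation.ReflTransGen (CommStep R)

variable {R : I → I → Prop} {L M : List I}

theorem CommStep.symm (hR : ∀ a b, R a b → R b a) (h : CommStep R L M) : CommStep R M L := by
  induction h with
  | swap L h => exact .swap L (hR _ _ h)
  | cons a _ ih => exact .cons a ih

theorem CommEquiv.symm (hR : ∀ a b, R a b → R b a) (h : CommEquiv R L M) : CommEquiv R M L := by
  induction h with
  | refl => exact .refl
  | tail _ h ih => exact .head (h.symm hR) ih

theorem CommStep.append_left (u : List I) (h : CommStep R L M) : CommStep R (u ++ L) (u ++ M) := by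
  induction u with
  | nil => exact h
  | cons a u ih => exact .cons a ih

theorem CommStep.append_right (u : List I) (h : CommStep R L M) :
    CommStep R (L ++ u) (M ++ u) := by
  induction h with
  | swap L h => exact .swap (L ++ u) h
  | cons a _ ih => exact .cons a ih

theorem CommStep.reverse (hR : ∀ a b, R a b → R b a) (h : CommStep R L M) :
    CommStep R L.reverse M.reverse := by
  induction h with
  | swap L h => simpa using (CommStep.swap [] (hR _ _ h)).append_left L.reverse
  | cons a _ ih => simpa using ih.append_right [a]

theorem CommEquiv.reverse (hR : ∀ a b, R a b → R b a) (h : CommEquiv R L M) :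
    CommEquiv R L.reverse M.reverse :=
  h.lift _ fun _ _ h => h.reverse hR

theorem CommEquiv.cons (a : I) (h : CommEquiv R L M) : CommEquiv R (a :: L) (a :: M) :=
  h.lift _ fun _ _ h => .cons a h

theorem CommStep.perm (h : CommStep R L M) : L.Perm M := by
  induction h with
  | swap L h => exact .swap ..
  | cons a _ ih => exact .cons a ih

theorem CommEquiv.perm (h : CommEquiv R L M) : L.Perm M := by
  induction h with
  | refl => exact .refl _
  | tail _ h ih => exact ih.trans h.perm

/-- Finiteness is what makes `Nat.card` additive when the class is split by its first letter. -/
instance (L : List I) : Finite {M // CommEquiv R L M} := by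
  classical
  refine Set.Finite.subset (s := {M | M ∈ L.permutations}) (List.finite_toSet _) ?_
  intro M hM
  exact List.mem_permutations.2 (CommEquiv.perm hM).symm

/-- The letter `x` occurs in the list and all letters before its first occurrence commute with
it. -/
def CanLead (R : I → I → Prop) (x : I) : List I → Prop
  | [] => False
  | a :: L => a = x ∨ (R a x ∧ CanLead R x L)

/-- Leading is a property of the class: a swap either leaves the letters before `x` as a set, or
moves a letter past `x` that commutes with it. -/
theorem CommStep.canLead (hR : ∀ a b, R a b → R b a) (h : CommStep R L M) {x : I}
    (hx : CanLead R x L) : CanLead R x M := by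
  induction h with
  | swap L h =>
    simp only [CanLead] at hx ⊢
    rcases hx with rfl | ⟨h1, rfl | h2⟩
    · exact Or.inr ⟨hR _ _ h, Or.inl rfl⟩
    · exact Or.inl rfl
    · exact Or.inr ⟨h2.1, Or.inr ⟨h1, h2.2⟩⟩
  | cons a _ ih =>
    rcases hx with rfl | ⟨h1, h2⟩
    · exact Or.inl rfl
    · exact Or.inr ⟨h1, ih h2⟩

theorem CommEquiv.canLead (hR : ∀ a b, R a b → R b a) (h : CommEquiv R L M) {x : I}
    (hx : CanLead R x L) : CanLead R x M := by
  induction h with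
  | refl => exact hx
  | tail _ h ih => exact h.canLead hR ih

theorem card_commClass_nil : Nat.card {M // CommEquiv R ([] : List I) M} = 1 := by
  have : Unique {M // CommEquiv R ([] : List I) M} :=
    { default := ⟨[], .refl⟩
      uniq := fun M => Subtype.ext (CommEquiv.perm M.2).symm.eq_nil }
  exact Nat.card_unique

/-- The removable letters of the peak word are those that can be moved to its end. Reversal brings
them to the front, where lists are easily taken apart. -/
theorem card_commClass_reverse (hR : ∀ a b, R a b → R b a) (L : List I) :
    Nat.card {M // CommEquiv R L.reverse M} = Nat.card {M // CommEquiv R L M} := by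
  refine Nat.card_congr ⟨fun M => ⟨M.1.reverse, by simpa using M.2.reverse hR⟩,
    fun M => ⟨M.1.reverse, M.2.reverse hR⟩, fun M => by simp, fun M => by simp⟩

theorem commStep_of_getElem? {k : ℕ} {a b : I} (ha : L[k]? = some a) (hb : L[k + 1]? = some b)
    (h : R a b) (hM : ∀ r, M[r]? = L[Equiv.swap k (k + 1) r]?) : CommStep R L M := by
  induction k generalizing L M with
  | zero =>
    match L with
    | [] => simp at ha
    | [_] => simp at hb
    | a' :: b' :: L =>
      simp only [List.getElem?_cons_zero, List.getElem?_cons_succ, Option.some.injEq, zero_add]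
        at ha hb
      subst ha hb
      have e : M = b' :: a' :: L := by
        apply List.ext_getElem?
        intro r
        rw [hM]
        match r with
        | 0 => simp
        | 1 => simp
        | r + 2 => rw [Equiv.swap_apply_of_ne_of_ne (by omega) (by omega)]; simp
      rw [e]
      exact .swap L h
  | succ k ih =>
    match L with
    | [] => simp at ha
    | a' :: L =>
      have h0 := hM 0
      rw [Equiv.swap_apply_of_ne_of_ne (by omega) (by omega)] at h0
      match M with
      | [] => simp at h0
      | b' :: M =>
        simp only [List.getElem?_cons_zero, Option.some.injEq] at h0
        subst h0
        refine .cons _ (ih ha hb fun r => ?_)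
        have := hM (r + 1)
        rw [List.getElem?_cons_succ] at this
        rw [this, eq_comm, ← List.getElem?_cons_succ (a := b')]
        congr 1
        simp only [Equiv.swap_apply_def]
        split_ifs <;> omega

theorem CommStep.exists_getElem? (h : CommStep R L M) :
    ∃ (k : ℕ) (a b : I), L[k]? = some a ∧ L[k + 1]? = some b ∧ R a b ∧
      ∀ r, M[r]? = L[Equiv.swap k (k + 1) r]? := by
  induction h with
  | @swap a b L h =>
    refine ⟨0, a, b, rfl, rfl, h, fun r => ?_⟩
    match r with
    | 0 => simp
    | 1 => simp
    | r + 2 => rw [Equiv.swap_apply_of_ne_of_ne (by omega) (by omega)]; simp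
  | @cons c L M h ih =>
    obtain ⟨k, a, b, ha, hb, hab, hM⟩ := ih
    refine ⟨k + 1, a, b, by simpa using ha, by simpa using hb, hab, fun r => ?_⟩
    match r with
    | 0 => rw [Equiv.swap_apply_of_ne_of_ne (by omega) (by omega)]; simp
    | r + 1 =>
      rw [List.getElem?_cons_succ, hM, ← List.getElem?_cons_succ (a := c)]
      congr 1
      simp only [Equiv.swap_apply_def]
      split_ifs <;> omega

variable [DecidableEq I]

/-- If the swapped pair contains the erased occurrence of `x`, both lists become equal; otherwise
the swap survives. This zero-or-one alternative is why the conclusion is an equivalence and not a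
step. -/
theorem CommStep.erase (h : CommStep R L M) (x : I) :
    CommEquiv R (L.erase x) (M.erase x) := by
  induction h with
  | @swap a b L h =>
    by_cases h1 : a = x
    · by_cases h2 : b = x
      · subst h1 h2
        exact .refl
      · subst h1
        rw [List.erase_cons_head, List.erase_cons_tail (by simpa using h2), List.erase_cons_head]
    · by_cases h2 : b = x
      · subst h2
        rw [List.erase_cons_head, List.erase_cons_tail (by simpa using h1), List.erase_cons_head]
      · simp only [List.erase_cons, beq_iff_eq, h1, h2, if_false]
        exact .single (.swap _ h)
  | cons a h ih =>
    by_cases h1 : a = x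
    · subst h1
      simpa using .single h
    · simp only [List.erase_cons, beq_iff_eq, h1, if_false]
      exact CommEquiv.cons a ih

theorem CommEquiv.erase (h : CommEquiv R L M) (x : I) :
    CommEquiv R (L.erase x) (M.erase x) := by
  induction h with
  | refl => exact .refl
  | tail _ h ih => exact ih.trans (h.erase x)

theorem CanLead.commEquiv (hR : ∀ a b, R a b → R b a) {x : I} (hx : CanLead R x L) :
    CommEquiv R (x :: L.erase x) L := by
  induction L with
  | nil => exact hx.elim
  | cons a L ih =>
    by_cases h : a = x
    · subst h
      rw [List.erase_cons_head]
    · obtain ⟨h1, h2⟩ := hx.resolve_left h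
      rw [List.erase_cons_tail (by simpa using h)]
      exact .head (.swap _ (hR _ _ h1)) (CommEquiv.cons a (ih h2))

/-- A commutation class, split according to the first letter. -/
def commClassEquiv (hR : ∀ a b, R a b → R b a) (hL : L ≠ []) :
    {M // CommEquiv R L M} ≃
      Σ x : {x // CanLead R x L}, {M // CommEquiv R (L.erase x.1) M} where
  toFun M := 
    have hM : M.1 ≠ [] := fun h => hL (by
      have := CommEquiv.perm M.2
      rw [h] at this
      exact this.eq_nil)
    ⟨⟨M.1.head hM, (M.2.symm hR).canLead hR (by
        obtain ⟨a, T, h⟩ := List.exists_cons_of_ne_nil hM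
        simp only [h]
        exact Or.inl rfl)⟩, ⟨M.1.tail, by
      have := M.2.erase (M.1.head hM)
      obtain ⟨a, T, h⟩ := List.exists_cons_of_ne_nil hM
      simp only [h, List.head_cons, List.erase_cons_head, List.tail_cons] at this ⊢
      exact this⟩⟩
  invFun y := ⟨y.1.1 :: y.2.1, ((y.1.2.commEquiv hR).symm hR).trans (CommEquiv.cons _ y.2.2)⟩
  left_inv M := Subtype.ext (by simp)
  right_inv y := by simp

theorem card_commClass [Fintype I] (hR : ∀ a b, R a b → R b a) (hL : L ≠ [])
    [DecidablePred fun x => CanLead R x L] :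
    Nat.card {M // CommEquiv R L M} =
      ∑ x with CanLead R x L, Nat.card {M // CommEquiv R (L.erase x) M} := by
  rw [Nat.card_congr (commClassEquiv hR hL), Nat.card_sigma,
    Finset.sum_subtype (p := fun x => CanLead R x L) _ (by simp)]

end Traces

/-! ### Components of the weight graph as commutation classes -/

section Component

/-- Two letters are distinct and not neighbors. -/
def Far {I : Type*} (Q : SimpleQuiver I) (a b : I) : Prop := a ≠ b ∧ ¬ Q.Nbr a b

theorem Far.symm {I : Type*} {Q : SimpleQuiver I} (a b : I) (h : Far Q a b) : Far Q b a :=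
  ⟨h.1.symm, fun h' => h.2 h'.symm⟩

variable {I : Type*} [Fintype I] [DecidableEq I] {Q : SimpleQuiver I} {α : I → ℕ}

theorem getElem?_ofFn_swap (w : Word α) (k : ℕ) (hk : k + 1 < height α) (r : ℕ) :
    (List.ofFn (w.swap k hk).1)[r]? = (List.ofFn w.1)[Equiv.swap k (k + 1) r]? := by
  simp only [List.getElem?_ofFn]
  have e : ∀ h : r < height α, (Equiv.swap (lo hk) (hi hk) ⟨r, h⟩).val =
      Equiv.swap k (k + 1) r := by
    intro h
    simp only [Equiv.swap_apply_def, lo, hi, Fin.ext_iff]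
    split_ifs <;> rfl
  by_cases h : r < height α
  · have h' : Equiv.swap k (k + 1) r < height α := by rw [← e h]; exact Fin.is_lt _
    rw [dif_pos h, dif_pos h']
    congr 1
    exact congrArg w.1 (Fin.ext (e h))
  · have h' : ¬ Equiv.swap k (k + 1) r < height α := by
      rw [Equiv.swap_apply_of_ne_of_ne (by omega) (by omega)]
      exact h
    rw [dif_neg h, dif_neg h']

theorem commStep_of_adj {w v : Word α} (h : (weightGraph Q α).Adj w v) :
    CommStep (Far Q) (List.ofFn w.1) (List.ofFn v.1) := by
  obtain ⟨k, hk, ha, rfl⟩ := h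
  exact commStep_of_getElem? (k := k) (a := w (lo hk)) (b := w (hi hk))
    (by rw [List.getElem?_ofFn, dif_pos (by omega)]; rfl)
    (by rw [List.getElem?_ofFn, dif_pos (by omega)]; rfl) ha (getElem?_ofFn_swap w k hk)

theorem exists_adj_of_commStep {w : Word α} {M : List I}
    (h : CommStep (Far Q) (List.ofFn w.1) M) :
    ∃ v : Word α, List.ofFn v.1 = M ∧ (weightGraph Q α).Adj w v := by
  obtain ⟨k, a, b, ha, hb, hab, hM⟩ := h.exists_getElem?
  rw [List.getElem?_ofFn] at ha hb
  have hk : k + 1 < height α := by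
    by_contra hk
    rw [dif_neg hk] at hb
    simp at hb
  rw [dif_pos (by omega)] at ha hb
  simp only [Option.some.injEq] at ha hb
  subst ha hb
  exact ⟨w.swap k hk, List.ext_getElem? fun r => by rw [hM, getElem?_ofFn_swap], k, hk, hab, rfl⟩

theorem commEquiv_of_reachable {w v : Word α} (h : (weightGraph Q α).Reachable w v) :
    CommEquiv (Far Q) (List.ofFn w.1) (List.ofFn v.1) := by
  obtain ⟨p⟩ := h
  induction p with
  | nil => exact .refl
  | cons h _ ih => exact .head (commStep_of_adj h) ih

theorem exists_reachable_of_commEquiv {w : Word α} {M : List I}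
    (h : CommEquiv (Far Q) (List.ofFn w.1) M) :
    ∃ v : Word α, List.ofFn v.1 = M ∧ (weightGraph Q α).Reachable w v := by
  induction h with
  | refl => exact ⟨w, rfl, .refl _⟩
  | tail _ h ih =>
    obtain ⟨v, rfl, hv⟩ := ih
    obtain ⟨u, rfl, hu⟩ := exists_adj_of_commStep h
    exact ⟨u, rfl, hv.trans hu.reachable⟩

/-- A commutation of the underlying list is a swap of two positions of the word, so the content is
kept and nothing is lost in passing to lists. Unlike words, lists can lose a letter without a change
of type. -/
theorem card_supp (w : Word α) :
    Nat.card {v : Word α // v ∈ ((weightGraph Q α).connectedComponentMk w).supp} =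
      Nat.card {M // CommEquiv (Far Q) (List.ofFn w.1) M} := by
  refine Nat.card_eq_of_bijective (fun v => ⟨List.ofFn v.1.1, commEquiv_of_reachable
    (SimpleGraph.ConnectedComponent.exact v.2).symm⟩) ⟨fun v v' h => ?_, fun M => ?_⟩
  · exact Subtype.ext (Subtype.ext (List.ofFn_injective (congrArg Subtype.val h)))
  · obtain ⟨v, hv, hr⟩ := exists_reachable_of_commEquiv M.2
    exact ⟨⟨v, SimpleGraph.ConnectedComponent.sound hr.symm⟩, Subtype.ext hv⟩

theorem finrank_homogeneousModule (F : Type*) [Field F] (C : HomogeneousComponent Q α) :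
    Module.finrank F (HomogeneousModule F C) = Nat.card {w : Word α // w ∈ C.1.supp} :=
  Module.finrank_eq_nat_card_basis (HomogeneousModule.basis F C)

theorem ofFn_ofList (L : List I) : List.ofFn (Word.ofList L).1 = L := by
  apply List.ext_getElem
  · rw [List.length_ofFn, height_content]
  · intro r h1 h2
    simp [Word.ofList]

end Component

/-! ### The algebraic identity behind the hook length formula -/

section Interpolation

open Polynomial

/-- Division of `z ∏ (z - x_b - 1)` by `∏ (z - x_b)`: the quotient is `z - |s|` and the leading
term of the remainder is explicit. -/
theorem exists_shifted_nodal_remainder (s : Finset ℕ) (x : ℕ → ℚ) :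
    ∃ r : ℚ[X], r.degree < s.card ∧
      X * ∏ b ∈ s, (X - C (x b) - 1) = (X - C (s.card : ℚ)) * ∏ b ∈ s, (X - C (x b)) + r ∧
      r.coeff (s.card - 1) = ∑ a ∈ s, (((s.filter (a < ·)).card : ℚ) - x a) := by
  induction s using Finset.induction_on_max with
  | empty => exact ⟨0, by simp⟩
  | insert c s hc ih =>
    obtain ⟨r, h1, h2, h3⟩ := ih
    have hcs : c ∉ s := fun h => lt_irrefl _ (hc c h)
    have hmonic : (∏ b ∈ s, (X - C (x b))).Monic := monic_prod_of_monic _ _ fun b _ => monic_X_sub_C _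
    have hdeg : (∏ b ∈ s, (X - C (x b))).natDegree = s.card := by
      simp [natDegree_prod_of_monic _ _ fun b _ => monic_X_sub_C (x b)]
    -- With `k = |s|`, multiply the identity for `s` by `z - x_c - 1` and use `(z - x_c - 1)(z - k)
    -- = (z - k - 1)(z - x_c) + (k - x_c)`.
    refine ⟨C (s.card - x c) * ∏ b ∈ s, (X - C (x b)) + (X * r - C (x c + 1) * r), ?_, ?_, ?_⟩
    · rw [Finset.card_insert_of_notMem hcs, degree_lt_iff_coeff_zero]
      intro m hm
      rw [degree_lt_iff_coeff_zero] at h1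
      obtain ⟨m, rfl⟩ : ∃ k, m = k + 1 := ⟨m - 1, by omega⟩
      rw [coeff_add, coeff_sub, coeff_C_mul, coeff_C_mul, coeff_X_mul, h1 _ (by omega),
        h1 _ (by omega), coeff_eq_zero_of_natDegree_lt (by omega)]
      simp
    · rw [Finset.card_insert_of_notMem hcs, Finset.prod_insert hcs, Finset.prod_insert hcs]
      have : X * ((X - C (x c) - 1) * ∏ b ∈ s, (X - C (x b) - 1)) =
          (X - C (x c) - 1) * (X * ∏ b ∈ s, (X - C (x b) - 1)) := by ring
      rw [this, h2]
      push_cast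
      simp only [C_add, C_sub, C_1]
      ring
    · rw [Finset.card_insert_of_notMem hcs, Finset.sum_insert hcs, Nat.add_sub_cancel]
      rw [degree_lt_iff_coeff_zero] at h1
      have e1 : (∏ b ∈ s, (X - C (x b))).coeff s.card = 1 := by
        rw [← hdeg]
        exact hmonic
      -- For empty `s` the index `s.card - 1` truncates to `0`; both sides vanish there because `r`
      -- has degree below `0`.
      have e2 : (X * r).coeff s.card = r.coeff (s.card - 1) := by
        rcases Nat.eq_zero_or_pos s.card with h | h
        · rw [h, coeff_X_mul_zero, h1 _ (by omega)]
        · obtain ⟨m, hm⟩ : ∃ k, s.card = k + 1 := ⟨s.card - 1, by omega⟩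
          rw [hm, coeff_X_mul, Nat.add_sub_cancel]
      rw [coeff_add, coeff_sub, coeff_C_mul, coeff_C_mul, e1, e2, h1 _ le_rfl, h3]
      have e3 : (insert c s).filter (c < ·) = ∅ := by
        rw [Finset.filter_eq_empty_iff]
        intro b hb
        rcases Finset.mem_insert.1 hb with rfl | hb
        · exact lt_irrefl _
        · exact (hc b hb).not_gt
      -- The new maximum `c` lies above every `a ∈ s`; the `|s|` resulting ones account for the
      -- `|s|` in the coefficient `|s| - x c`.
      have e4 : ∀ a ∈ s, (((insert c s).filter (a < ·)).card : ℚ) - x a =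
          1 + (((s.filter (a < ·)).card : ℚ) - x a) := by
        intro a ha
        rw [Finset.filter_insert, if_pos (hc a ha), Finset.card_insert_of_notMem (by simp [hcs])]
        push_cast
        ring
      rw [e3, Finset.sum_congr rfl e4, Finset.sum_add_distrib]
      simp
      ring

/-- At `z = x_a` the quotient term of the division vanishes and the factor `b = a` of the shifted
product is `-1`, so up to sign the numerators are the values of the remainder at the nodes. Lagrange
interpolation then recovers the top coefficient of the remainder as the sum. -/
theorem sum_mul_prod_sub_one_div (s : Finset ℕ) (x : ℕ → ℚ) (hx : Set.InjOn x s) :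
    ∑ a ∈ s, x a * ∏ b ∈ s.erase a, ((x a - x b - 1) / (x a - x b)) =
      ∑ a ∈ s, (x a - ((s.filter (a < ·)).card : ℚ)) := by
  rcases s.eq_empty_or_nonempty with rfl | hs
  · simp
  obtain ⟨r, h1, h2, h3⟩ := exists_shifted_nodal_remainder s x
  have hev : ∀ a ∈ s, r.eval (x a) = - (x a * ∏ b ∈ s.erase a, (x a - x b - 1)) := by
    intro a ha
    have h4 := congrArg (Polynomial.eval (x a)) h2
    simp only [eval_mul, eval_add, eval_prod, eval_X, eval_sub, eval_C, eval_one] at h4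
    rw [Finset.prod_eq_zero (i := a) (f := fun b => x a - x b) ha (sub_self _),
      ← Finset.mul_prod_erase s _ ha] at h4
    linarith
  have h5 := Lagrange.coeff_eq_sum hx h1
  rw [h3] at h5
  have h6 : ∀ a ∈ s, x a * ∏ b ∈ s.erase a, ((x a - x b - 1) / (x a - x b)) =
      - (r.eval (x a) / ∏ b ∈ s.erase a, (x a - x b)) := by
    intro a ha
    rw [hev a ha, Finset.prod_div_distrib]
    ring
  rw [Finset.sum_congr rfl h6, Finset.sum_neg_distrib, ← h5, ← Finset.sum_neg_distrib]
  simp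

end Interpolation

/-! ### Systems of rows -/

/-- The intervals `[i r, j r]`, `r < p`, of letters in `{1, …, n}` (empty if `i r = j r + 1`), with
strictly increasing ends, such that each interval either ends one letter after the preceding one
or is separated from it by a letter. They are the rows of Young diagrams, a row having its
greatest letter on the left. -/
structure IsRowSystem (n p : ℕ) (i j : ℕ → ℕ) : Prop where
  pos : ∀ r < p, 1 ≤ i r
  le : ∀ r < p, i r ≤ j r + 1
  bound : ∀ r < p, j r ≤ n
  lower_lt : ∀ r, r + 1 < p → i r < i (r + 1)
  upper_lt : ∀ r, r + 1 < p → j r < j (r + 1)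
  conn : ∀ r, r + 1 < p → j (r + 1) = j r + 1 ∨ j r + 2 ≤ i (r + 1)

/-- The first letter of the row `a` may be removed. -/
def IsCorner (p : ℕ) (i j : ℕ → ℕ) (a : ℕ) : Prop := i a ≤ j a ∧ (a + 1 < p → i a + 1 < i (a + 1))

instance (p : ℕ) (i j : ℕ → ℕ) : DecidablePred (IsCorner p i j) := fun _ =>
  inferInstanceAs (Decidable (_ ∧ _))

/-- The lower ends after removal of the first letter of the row `a`. -/
def removeFirst (i : ℕ → ℕ) (a : ℕ) : ℕ → ℕ := Function.update i a (i a + 1)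

theorem removeFirst_self (i : ℕ → ℕ) (a : ℕ) : removeFirst i a a = i a + 1 :=
  Function.update_self ..

theorem removeFirst_of_ne (i : ℕ → ℕ) {a r : ℕ} (h : r ≠ a) : removeFirst i a r = i r :=
  Function.update_of_ne h ..

theorem removeFirst_apply (i : ℕ → ℕ) (a r : ℕ) :
    removeFirst i a r = if r = a then i a + 1 else i r :=
  Function.update_apply ..

theorem step_lt_of_lt {p : ℕ} {f : ℕ → ℕ} (h : ∀ r, r + 1 < p → f r < f (r + 1)) {r s : ℕ}
    (hrs : r < s) (hs : s < p) : f r < f s := by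
  induction s with
  | zero => omega
  | succ s ih =>
    rcases Nat.lt_succ_iff_lt_or_eq.1 hrs with h' | rfl
    · exact (ih h' (by omega)).trans (h s hs)
    · exact h _ hs

namespace IsRowSystem

variable {n p : ℕ} {i j : ℕ → ℕ}

theorem lower_strictMono (h : IsRowSystem n p i j) {r s : ℕ} (hrs : r < s) (hs : s < p) :
    i r < i s := step_lt_of_lt h.lower_lt hrs hs

theorem of_le (h : IsRowSystem n p i j) {q : ℕ} (hq : q ≤ p) : IsRowSystem n q i j :=
  ⟨fun r hr => h.pos r (by omega), fun r hr => h.le r (by omega), fun r hr => h.bound r (by omega),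
    fun r hr => h.lower_lt r (by omega), fun r hr => h.upper_lt r (by omega),
    fun r hr => h.conn r (by omega)⟩

theorem removeFirst (h : IsRowSystem n p i j) {a : ℕ} (ha : IsCorner p i j a) :
    IsRowSystem n p (removeFirst i a) j where
  pos r hr := by
    have := h.pos r hr
    rw [removeFirst_apply]
    split_ifs <;> omega
  le r hr := by
    have := h.le r hr
    have := ha.1
    rw [removeFirst_apply]
    split_ifs with h1
    · subst h1; omega
    · omega
  bound := h.bound
  lower_lt r hr := by
    have := h.lower_lt r hr
    rw [removeFirst_apply, removeFirst_apply]
    split_ifs with h1 h2 h2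
    · omega
    · subst h1
      exact ha.2 hr
    · subst h2
      omega
    · omega
  upper_lt := h.upper_lt
  conn r hr := by
    have := h.conn r hr
    rw [removeFirst_apply]
    split_ifs with h1
    · subst h1; omega
    · omega

end IsRowSystem

/-! ### The word of a system of rows -/

/-- The letters of the interval `[i, j]` in increasing order. -/
def rowList (n i j : ℕ) : List (Fin n) := (segment n i j).reverse

theorem mem_rowList {n i j : ℕ} {a : Fin n} :
    a ∈ rowList n i j ↔ i ≤ a.val + 1 ∧ a.val + 1 ≤ j := by
  rw [rowList, List.mem_reverse, mem_segment]

theorem rowList_eq_nil {n i j : ℕ} (h : j < i) : rowList n i j = [] := by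
  rw [List.eq_nil_iff_forall_not_mem]
  intro a ha
  have := mem_rowList.1 ha
  omega

theorem rowList_pairwise (n i j : ℕ) : (rowList n i j).Pairwise (· < ·) := by
  rw [rowList, List.pairwise_reverse]
  exact segment_pairwise n i j

theorem rowList_eq_cons {n i j : ℕ} {a : Fin n} (ha : a.val + 1 = i) (h : i ≤ j) :
    rowList n i j = a :: rowList n (i + 1) j := by
  have h1 : (a :: rowList n (i + 1) j).Pairwise (· < ·) :=
    List.pairwise_cons.2 ⟨fun b hb => by
      have := mem_rowList.1 hb
      rw [Fin.lt_def]
      omega, rowList_pairwise ..⟩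
  refine List.Perm.eq_of_pairwise' (rowList_pairwise ..) h1 ?_
  rw [List.perm_ext_iff_of_nodup (rowList_pairwise ..).nodup h1.nodup]
  intro b
  rw [List.mem_cons, mem_rowList, mem_rowList, Fin.ext_iff]
  omega

/-- The rows, from the last one to the first one, each in increasing order. -/
def rowWord (n : ℕ) : ℕ → (ℕ → ℕ) → (ℕ → ℕ) → List (Fin n)
  | 0, _, _ => []
  | p + 1, i, j => rowList n (i p) (j p) ++ rowWord n p i j

theorem rowWord_congr {n p : ℕ} {i i' j j' : ℕ → ℕ} (hi : ∀ r < p, i r = i' r)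
    (hj : ∀ r < p, j r = j' r) : rowWord n p i j = rowWord n p i' j' := by
  induction p with
  | zero => rfl
  | succ p ih =>
    rw [rowWord, rowWord, hi p (by omega), hj p (by omega),
      ih (fun r hr => hi r (by omega)) fun r hr => hj r (by omega)]

theorem rowWord_eq_nil {n p : ℕ} {i j : ℕ → ℕ} (h : ∀ r < p, j r < i r) :
    rowWord n p i j = [] := by
  induction p with
  | zero => rfl
  | succ p ih =>
    rw [rowWord, rowList_eq_nil (h p (by omega)), ih fun r hr => h r (by omega), List.append_nil]

theorem mem_rowWord_of_mem {n p : ℕ} {i j : ℕ → ℕ} {r : ℕ} (hr : r < p) {a : Fin n}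
    (ha : a ∈ rowList n (i r) (j r)) : a ∈ rowWord n p i j := by
  induction p with
  | zero => omega
  | succ p ih =>
    rw [rowWord, List.mem_append]
    rcases Nat.lt_succ_iff_lt_or_eq.1 hr with hr | rfl
    · exact Or.inr (ih hr)
    · exact Or.inl ha

theorem far_of_typeA {n : ℕ} {Q : SimpleQuiver (Fin n)} (hQ : Q.IsTypeA) {a b : Fin n} :
    Far Q a b ↔ a.val + 1 < b.val ∨ b.val + 1 < a.val := by
  rw [Far, hQ, Ne, Fin.ext_iff]
  omega

theorem canLead_append_right {I : Type*} {R : I → I → Prop} {x : I} {L M : List I}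
    (hL : ∀ a ∈ L, R a x) (hM : CanLead R x M) : CanLead R x (L ++ M) := by
  induction L with
  | nil => exact hM
  | cons a L ih =>
    exact Or.inr ⟨hL a (by simp), ih fun b hb => hL b (by simp [hb])⟩

theorem CanLead.of_append {I : Type*} {R : I → I → Prop} {x : I} {L M : List I}
    (h : CanLead R x (L ++ M)) : CanLead R x L ∨ ((∀ a ∈ L, R a x) ∧ CanLead R x M) := by
  induction L with
  | nil => exact Or.inr ⟨by simp, h⟩
  | cons a L ih =>
    rcases h with h | ⟨h1, h2⟩
    · exact Or.inl (Or.inl h)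
    · rcases ih h2 with h3 | ⟨h3, h4⟩
      · exact Or.inl (Or.inr ⟨h1, h3⟩)
      · exact Or.inr ⟨by simpa [h1] using h3, h4⟩

theorem CanLead.mem {I : Type*} {R : I → I → Prop} {x : I} {L : List I}
    (h : CanLead R x L) : x ∈ L := by
  induction L with
  | nil => exact h.elim
  | cons a L ih =>
    rcases h with rfl | ⟨-, h⟩
    · simp
    · simp [ih h]

section RowWord

variable {n p : ℕ} {i j : ℕ → ℕ} {Q : SimpleQuiver (Fin n)}

/-- In an increasing interval every letter but the first is preceded by its lower neighbor, which it
cannot pass. -/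
theorem CanLead.val_add_one_eq (hQ : Q.IsTypeA) {i j : ℕ} (hi : 1 ≤ i) {x : Fin n}
    (h : CanLead (Far Q) x (rowList n i j)) : x.val + 1 = i := by
  induction hd : j + 1 - i generalizing i with
  | zero =>
    rw [rowList_eq_nil (by omega)] at h
    exact h.elim
  | succ d ih =>
    have hm := mem_rowList.1 h.mem
    rw [rowList_eq_cons (a := ⟨i - 1, by omega⟩) (by simp; omega) (by omega)] at h
    rcases h with h1 | ⟨h1, h2⟩
    · rw [← h1]
      simp; omega
    · have := ih (by omega) h2 (by omega)
      rw [far_of_typeA hQ] at h1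
      simp only at h1
      omega

/-- Before the row `a` stand only later rows, whose letters are at least `i (a + 1) > i a + 1`,
hence far from the letter `i a`. -/
theorem canLead_rowWord_of_isCorner (hQ : Q.IsTypeA) (h : IsRowSystem n p i j) {a : ℕ} (hap : a < p)
    (ha : IsCorner p i j a) {x : Fin n} (hx : x.val + 1 = i a) :
    CanLead (Far Q) x (rowWord n p i j) := by
  induction p with
  | zero => omega
  | succ p ih =>
    rw [rowWord]
    rcases Nat.lt_succ_iff_lt_or_eq.1 hap with hap' | rfl
    · refine canLead_append_right (fun b hb => ?_)
        (ih (h.of_le (by omega)) hap' ⟨ha.1, fun h' => ha.2 (by omega)⟩)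
      have h1 := mem_rowList.1 hb
      have h2 := ha.2 (by omega)
      have h3 : i (a + 1) ≤ i p := by
        rcases Nat.lt_or_eq_of_le (show a + 1 ≤ p by omega) with h' | rfl
        · exact (h.lower_strictMono h' (by omega)).le
        · exact le_rfl
      rw [far_of_typeA hQ]
      omega
    · rw [rowList_eq_cons hx ha.1]
      exact Or.inl rfl

/-- A leading letter is the first of its row `a`. If `i (a + 1) = i a + 1`, the next row stands
before it in the word and contains its upper neighbor, since the upper ends increase; so this case
is excluded. -/
theorem isCorner_of_canLead (hQ : Q.IsTypeA) (h : IsRowSystem n p i j) {x : Fin n}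
    (hx : CanLead (Far Q) x (rowWord n p i j)) :
    ∃ a < p, IsCorner p i j a ∧ x.val + 1 = i a := by
  induction p with
  | zero => exact hx.elim
  | succ p ih =>
    rw [rowWord] at hx
    rcases hx.of_append with h1 | ⟨h1, h2⟩
    · have hm := mem_rowList.1 h1.mem
      have he := h1.val_add_one_eq hQ (h.pos p (by omega))
      exact ⟨p, by omega, ⟨by omega, by omega⟩, he⟩
    · obtain ⟨a, hap, hc, hxa⟩ := ih (h.of_le (by omega)) h2
      refine ⟨a, by omega, ⟨hc.1, fun h' => ?_⟩, hxa⟩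
      rcases Nat.lt_or_eq_of_le (show a + 1 ≤ p by omega) with h3 | h3
      · exact hc.2 h3
      · subst h3
        have h4 := h.lower_lt a (by omega)
        have h5 := h.upper_lt a (by omega)
        by_contra h6
        have hbd := h.bound (a + 1) (by omega)
        have hc1 := hc.1
        -- The element of `Fin n` with value `i a` is the letter labelled `i a + 1`.
        have := h1 ⟨i a, by omega⟩ (mem_rowList.2 ⟨by simp; omega, by simp; omega⟩)
        rw [far_of_typeA hQ] at this
        simp only at this
        omega

/-- The letter `i a` may also occur in earlier rows, but these stand further back; later rows have
only greater letters, so its first occurrence is in the row `a`. -/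
theorem erase_rowWord (h : IsRowSystem n p i j) {a : ℕ} (hap : a < p)
    (ha : i a ≤ j a) {x : Fin n} (hx : x.val + 1 = i a) :
    (rowWord n p i j).erase x = rowWord n p (removeFirst i a) j := by
  induction p with
  | zero => omega
  | succ p ih =>
    rw [rowWord, rowWord]
    rcases Nat.lt_succ_iff_lt_or_eq.1 hap with hap' | rfl
    · rw [List.erase_append_right _ (fun hm => ?_), ih (h.of_le (by omega)) hap',
        removeFirst_of_ne _ (by omega)]
      have h1 := mem_rowList.1 hm
      have h2 := h.lower_strictMono hap' (by omega)
      omega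
    · rw [rowList_eq_cons hx ha, List.cons_append, List.erase_cons_head, removeFirst_self,
        rowWord_congr (i := removeFirst i a) (fun r hr => removeFirst_of_ne _ (by omega))
          fun _ _ => rfl]

/-- Lower ends increase strictly, so corners in different rows carry different letters and the sum
over leading letters is a sum over rows. -/
theorem card_commClass_rowWord (hQ : Q.IsTypeA) (h : IsRowSystem n p i j)
    (hne : ∃ r < p, i r ≤ j r) :
    Nat.card {M // CommEquiv (Far Q) (rowWord n p i j) M} =
      ∑ a ∈ Finset.range p with IsCorner p i j a,
        Nat.card {M // CommEquiv (Far Q) (rowWord n p (removeFirst i a) j) M} := by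
  classical
  obtain ⟨r, hr, hij⟩ := hne
  have hnil : rowWord n p i j ≠ [] := by
    have h1 := h.pos r hr
    have h2 := h.bound r hr
    exact List.ne_nil_of_mem (mem_rowWord_of_mem hr (a := ⟨i r - 1, by omega⟩)
      (mem_rowList.2 ⟨by simp; omega, by simp; omega⟩))
  rw [card_commClass Far.symm hnil]
  symm
  have hb : ∀ a ∈ (Finset.range p).filter (IsCorner p i j), i a - 1 < n ∧ 1 ≤ i a := by
    intro a ha
    rw [Finset.mem_filter, Finset.mem_range] at ha
    have h1 := h.pos a ha.1
    have h2 := h.bound a ha.1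
    have h3 := ha.2.1
    omega
  refine Finset.sum_bij (fun a ha => ⟨i a - 1, (hb a ha).1⟩) ?_ ?_ ?_ ?_
  · intro a ha
    have h1 := (hb a ha).2
    rw [Finset.mem_filter, Finset.mem_range] at ha
    exact Finset.mem_filter.2 ⟨Finset.mem_univ _,
      canLead_rowWord_of_isCorner hQ h ha.1 ha.2 (by simp; omega)⟩
  · intro a ha b hb' hab
    have h1 := (hb a ha).2
    have h2 := (hb b hb').2
    rw [Finset.mem_filter, Finset.mem_range] at ha hb'
    have h3 := congrArg Fin.val hab
    simp only at h3
    rcases lt_trichotomy a b with h4 | h4 | h4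
    · have := h.lower_strictMono h4 hb'.1
      omega
    · exact h4
    · have := h.lower_strictMono h4 ha.1
      omega
  · intro x hx
    obtain ⟨a, hap, hc, hxa⟩ := isCorner_of_canLead hQ h (Finset.mem_filter.1 hx).2
    exact ⟨a, by simp [hap, hc], Fin.ext (by simp; omega)⟩
  · intro a ha
    have h1 := (hb a ha).2
    rw [Finset.mem_filter, Finset.mem_range] at ha
    rw [erase_rowWord h ha.1 ha.2.1 (by simp; omega)]

end RowWord

/-! ### Hook lengths -/

/-- Among the `f` rows from the row `s` on, the number of rows in the leg of the hook of the
letter `J` of the row `s - 1`. -/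
def leg (i : ℕ → ℕ) : ℕ → ℕ → ℕ → ℕ
  | 0, _, _ => 0
  | f + 1, s, J => if i s ≤ J + 1 then leg i f (s + 1) (J + 1) + 1 else 0

/-- The hook length of the letter `J` in the row `r`. -/
def hook (p : ℕ) (i : ℕ → ℕ) (r J : ℕ) : ℕ := J - i r + 1 + leg i (p - (r + 1)) (r + 1) J

/-- The product of the hook lengths. -/
def hookProd (p : ℕ) (i j : ℕ → ℕ) : ℕ :=
  ∏ r ∈ Finset.range p, ∏ J ∈ Finset.Ico (i r) (j r + 1), hook p i r J

/-- The later rows in the same Young diagram as the row `r`. -/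
def laterRows (p : ℕ) (j : ℕ → ℕ) (r : ℕ) : Finset ℕ :=
  (Finset.range p).filter fun b => r < b ∧ j b + r = j r + b

theorem mem_laterRows {p : ℕ} {j : ℕ → ℕ} {r b : ℕ} :
    b ∈ laterRows p j r ↔ b < p ∧ r < b ∧ j b + r = j r + b := by
  simp [laterRows]

/-- The hook length of the first box of the row `r`, where trailing empty rows are counted as part
of a leg. -/
def shiftedLength (p : ℕ) (i j : ℕ → ℕ) (r : ℕ) : ℕ := j r + 1 - i r + (laterRows p j r).card

section RowSystemHooks

variable {n p : ℕ} {i j : ℕ → ℕ}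

namespace IsRowSystem

/-- The difference `j r - r` is weakly increasing. Its level sets, the diagrams, are therefore runs
of consecutive rows. -/
theorem add_le_upper (h : IsRowSystem n p i j) {r s : ℕ} (hrs : r ≤ s) (hs : s < p) :
    j r + s ≤ j s + r := by
  induction s with
  | zero =>
    obtain rfl : r = 0 := by omega
    exact le_rfl
  | succ s ih =>
    rcases Nat.lt_or_eq_of_le hrs with h' | rfl
    · have h1 := ih (by omega) (by omega)
      have h2 := h.upper_lt s hs
      omega
    · exact le_rfl

theorem laterRows_eq_empty (h : IsRowSystem n p i j) {r : ℕ} (hr : r + 1 < p)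
    (hj : j (r + 1) ≠ j r + 1) : laterRows p j r = ∅ := by
  rw [Finset.eq_empty_iff_forall_notMem]
  intro b hb
  rw [mem_laterRows] at hb
  have h1 := h.add_le_upper (show r + 1 ≤ b by omega) hb.1
  have h2 := h.upper_lt r hr
  omega

theorem laterRows_eq_insert (hr : r + 1 < p) (hj : j (r + 1) = j r + 1) :
    laterRows p j r = insert (r + 1) (laterRows p j (r + 1)) := by
  ext b
  rw [Finset.mem_insert, mem_laterRows, mem_laterRows]
  by_cases hb : b = r + 1
  · subst hb
    omega
  · omega

/-- The hook lengths of a row and its differences to the later rows together fill an interval. If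
the next row is in the same diagram, letters below `i (r + 1) - 1` have an empty leg, the value at
`v = i (r + 1) - 1` is supplied by the difference `i (r + 1) - i₀`, and each remaining letter `J`
has one more leg row than `J + 1` in the row `r + 1`. The base `i₀` stays fixed while the start `t`
moves to `i (r + 1)`, whence two parameters. -/
theorem prod_leg_mul_prod (h : IsRowSystem n p i j) (f r : ℕ) (hf : r + 1 + f = p) (i₀ t : ℕ)
    (hi : i₀ ≤ t) (ht : t ≤ j r + 1) (hts : r + 1 < p → t < i (r + 1)) :
    (∏ J ∈ Finset.Ico t (j r + 1), (J - i₀ + 1 + leg i f (r + 1) J)) *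
        ∏ b ∈ laterRows p j r, (i b - i₀) =
      ∏ v ∈ Finset.Ico t (j r + 1 + (laterRows p j r).card), (v - i₀ + 1) := by
  induction f generalizing r t with
  | zero =>
    have : laterRows p j r = ∅ := by
      rw [Finset.eq_empty_iff_forall_notMem]
      intro b hb
      rw [mem_laterRows] at hb
      omega
    simp [this, leg]
  | succ f ih =>
    have hr : r + 1 < p := by omega
    have hts := hts hr
    by_cases hj : j (r + 1) = j r + 1
    · have h1 := h.le (r + 1) hr
      have hmem : r + 1 ∉ laterRows p j (r + 1) := by
        rw [mem_laterRows]
        omega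
      have h2 := ih (r + 1) (by omega) (i (r + 1)) (by omega) h1
        (fun h' => h.lower_lt (r + 1) h')
      rw [laterRows_eq_insert hr hj, Finset.prod_insert hmem, Finset.card_insert_of_notMem hmem,
        ← Finset.prod_Ico_consecutive _ (show t ≤ i (r + 1) - 1 by omega)
          (show i (r + 1) - 1 ≤ j r + 1 by omega),
        ← Finset.prod_Ico_consecutive _ (show t ≤ i (r + 1) by omega)
          (show i (r + 1) ≤ j r + 1 + ((laterRows p j (r + 1)).card + 1) by omega)]
      have e1 : ∏ J ∈ Finset.Ico t (i (r + 1) - 1), (J - i₀ + 1 + leg i (f + 1) (r + 1) J) =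
          ∏ J ∈ Finset.Ico t (i (r + 1) - 1), (J - i₀ + 1) := by
        refine Finset.prod_congr rfl fun J hJ => ?_
        rw [Finset.mem_Ico] at hJ
        rw [leg, if_neg (by omega), add_zero]
      have e2 : ∏ J ∈ Finset.Ico (i (r + 1) - 1) (j r + 1),
            (J - i₀ + 1 + leg i (f + 1) (r + 1) J) =
          ∏ J ∈ Finset.Ico (i (r + 1)) (j (r + 1) + 1),
            (J - i₀ + 1 + leg i f (r + 1 + 1) J) := by
        have e3 : Finset.Ico (i (r + 1)) (j (r + 1) + 1) =
            Finset.Ico (i (r + 1) - 1 + 1) (j r + 1 + 1) := by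
          rw [hj, Nat.sub_add_cancel (by omega)]
        rw [e3, ← Finset.prod_Ico_add' _ _ _ 1]
        refine Finset.prod_congr rfl fun J hJ => ?_
        rw [Finset.mem_Ico] at hJ
        rw [leg, if_pos (by omega)]
        omega
      have e4 : ∏ v ∈ Finset.Ico t (i (r + 1)), (v - i₀ + 1) =
          (∏ v ∈ Finset.Ico t (i (r + 1) - 1), (v - i₀ + 1)) * (i (r + 1) - i₀) := by
        obtain ⟨m, hm⟩ : ∃ m, i (r + 1) = m + 1 := ⟨i (r + 1) - 1, by omega⟩
        rw [hm, Finset.prod_Ico_succ_top (by omega), Nat.add_sub_cancel]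
        congr 1
        omega
      rw [e1, e2, e4, show j r + 1 + ((laterRows p j (r + 1)).card + 1) =
        j (r + 1) + 1 + (laterRows p j (r + 1)).card by omega, ← h2]
      ring
    -- A new diagram begins at the row `r + 1`, beyond the reach of any leg.
    · have h1 := (h.conn r hr).resolve_left hj
      rw [h.laterRows_eq_empty hr hj, Finset.prod_empty, mul_one, Finset.card_empty, add_zero]
      refine Finset.prod_congr rfl fun J hJ => ?_
      rw [Finset.mem_Ico] at hJ
      rw [leg, if_neg (by omega), add_zero]

theorem prod_hook_mul_prod (h : IsRowSystem n p i j) {r : ℕ} (hr : r < p) :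
    (∏ J ∈ Finset.Ico (i r) (j r + 1), hook p i r J) * ∏ b ∈ laterRows p j r, (i b - i r) =
      (shiftedLength p i j r).factorial := by
  have h1 := h.le r hr
  have h2 := h.prod_leg_mul_prod (p - (r + 1)) r (by omega) (i r) (i r) le_rfl h1
    (fun h' => h.lower_lt r h')
  unfold hook
  rw [h2, ← Finset.prod_range_add_one_eq_factorial, Finset.prod_Ico_eq_prod_range, shiftedLength,
    show j r + 1 + (laterRows p j r).card - i r = j r + 1 - i r + (laterRows p j r).card by omega]
  exact Finset.prod_congr rfl fun v _ => by omega

theorem hookProd_mul_prod (h : IsRowSystem n p i j) :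
    hookProd p i j * ∏ r ∈ Finset.range p, ∏ b ∈ laterRows p j r, (i b - i r) =
      ∏ r ∈ Finset.range p, (shiftedLength p i j r).factorial := by
  rw [hookProd, ← Finset.prod_mul_distrib]
  exact Finset.prod_congr rfl fun r hr => h.prod_hook_mul_prod (Finset.mem_range.1 hr)

/-- Shifted lengths in the same Young diagram differ as the lower ends do. -/
theorem shiftedLength_add (h : IsRowSystem n p i j) {r s : ℕ} (hrs : r ≤ s) (hs : s < p)
    (hj : j s + r = j r + s) :
    shiftedLength p i j r + i r = shiftedLength p i j s + i s := by
  induction s with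
  | zero =>
    obtain rfl : r = 0 := by omega
    rfl
  | succ s ih =>
    rcases Nat.lt_or_eq_of_le hrs with h' | rfl
    · have h1 := h.add_le_upper (show r ≤ s by omega) (by omega)
      have h2 := h.upper_lt s hs
      have hmem : s + 1 ∉ laterRows p j (s + 1) := by
        rw [mem_laterRows]
        omega
      have h3 := h.le s (by omega)
      have h4 := h.le (s + 1) hs
      rw [ih (by omega) (by omega) (by omega), shiftedLength, shiftedLength,
        laterRows_eq_insert hs (by omega), Finset.card_insert_of_notMem hmem]
      omega
    · rfl

end IsRowSystem

/-! ### Removal of a corner and the hook length recursion -/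

theorem hookProd_pos (p : ℕ) (i j : ℕ → ℕ) : 0 < hookProd p i j :=
  Finset.prod_pos fun r _ => Finset.prod_pos fun J _ => by rw [hook]; omega

/-- The rows in the same Young diagram as the row `a`. -/
def diagramRows (p : ℕ) (j : ℕ → ℕ) (a : ℕ) : Finset ℕ :=
  (Finset.range p).filter fun b => j b + a = j a + b

theorem mem_diagramRows {a b : ℕ} : b ∈ diagramRows p j a ↔ b < p ∧ j b + a = j a + b := by
  simp [diagramRows]

/-- The other rows of the diagram are the later and the earlier ones. The earlier ones are written
as an indicator over all rows so that they can be matched, row by row, with the double product of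
differences. -/
theorem prod_diagramRows_erase {a : ℕ} (hap : a < p) (u : ℕ → ℚ) :
    ∏ b ∈ (diagramRows p j a).erase a, u b =
      (∏ b ∈ laterRows p j a, u b) *
        ∏ r ∈ (Finset.range p).erase a, if a ∈ laterRows p j r then u r else 1 := by
  rw [← Finset.prod_filter, ← Finset.prod_union]
  · refine Finset.prod_congr ?_ fun _ _ => rfl
    ext b
    simp only [Finset.mem_erase, Finset.mem_union, Finset.mem_filter, mem_laterRows,
      mem_diagramRows, Finset.mem_range]
    omega
  · rw [Finset.disjoint_left]
    intro b hb hb'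
    simp only [Finset.mem_erase, Finset.mem_filter, mem_laterRows] at hb hb'
    omega

namespace IsRowSystem

theorem shiftedLength_sub (h : IsRowSystem n p i j) {a b : ℕ} (ha : a < p)
    (hb : b ∈ diagramRows p j a) :
    (shiftedLength p i j a : ℚ) - shiftedLength p i j b = (i b : ℚ) - i a := by
  rw [mem_diagramRows] at hb
  have key : shiftedLength p i j a + i a = shiftedLength p i j b + i b := by
    rcases le_total a b with h' | h'
    · exact h.shiftedLength_add h' hb.1 hb.2
    · exact (h.shiftedLength_add h' ha (by omega)).symm
  have : (shiftedLength p i j a : ℚ) + i a = shiftedLength p i j b + i b := by exact_mod_cast key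
  linarith

theorem lower_sub_ne_zero (h : IsRowSystem n p i j) {a b : ℕ} (ha : a < p) (hb : b < p)
    (hab : a ≠ b) : (i b : ℚ) - i a ≠ 0 := by
  intro h'
  have h1 : i b = i a := by exact_mod_cast sub_eq_zero.1 h'
  rcases lt_or_gt_of_ne hab with h2 | h2
  · have := h.lower_strictMono h2 hb
    omega
  · have := h.lower_strictMono h2 ha
    omega

theorem hookProd_mul_prod_rat (h : IsRowSystem n p i j) :
    (hookProd p i j : ℚ) * ∏ r ∈ Finset.range p, ∏ b ∈ laterRows p j r, ((i b : ℚ) - i r) =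
      ∏ r ∈ Finset.range p, ((shiftedLength p i j r).factorial : ℚ) := by
  have := congrArg (Nat.cast : ℕ → ℚ) h.hookProd_mul_prod
  push_cast at this
  rw [← this]
  congr 1
  refine Finset.prod_congr rfl fun r _ => Finset.prod_congr rfl fun b hb => ?_
  rw [mem_laterRows] at hb
  rw [Nat.cast_sub (h.lower_strictMono hb.2.1 hb.1).le]

/-- The factor by which the product of the hook lengths changes when a corner is removed. -/
theorem hookProd_div_hookProd_removeFirst (h : IsRowSystem n p i j) {a : ℕ} (hap : a < p)
    (ha : IsCorner p i j a) :
    (hookProd p i j : ℚ) / hookProd p (KLRDyck.removeFirst i a) j =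
      shiftedLength p i j a * ∏ b ∈ (diagramRows p j a).erase a,
        (((shiftedLength p i j a : ℚ) - shiftedLength p i j b - 1) /
          ((shiftedLength p i j a : ℚ) - shiftedLength p i j b)) := by
  have h' := h.removeFirst ha
  set i' := KLRDyck.removeFirst i a with hi'
  have hne : ∀ r, r ≠ a → i' r = i r := fun r hr => removeFirst_of_ne i hr
  have hself : i' a = i a + 1 := removeFirst_self i a
  have hD : ∀ r < p, ∀ b ∈ laterRows p j r, (i b : ℚ) - i r ≠ 0 := by
    intro r hr b hb
    rw [mem_laterRows] at hb
    exact h.lower_sub_ne_zero hr hb.1 hb.2.1.ne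
  have e1 := h.hookProd_mul_prod_rat
  have e2 := h'.hookProd_mul_prod_rat
  -- Only the shifted length of the row `a` changes; it drops by one.
  have e3 : ∏ r ∈ Finset.range p, ((shiftedLength p i j r).factorial : ℚ) =
      shiftedLength p i j a * ∏ r ∈ Finset.range p, ((shiftedLength p i' j r).factorial : ℚ) := by
    rw [← Finset.mul_prod_erase _ _ (Finset.mem_range.2 hap),
      ← Finset.mul_prod_erase (Finset.range p) (fun r => ((shiftedLength p i' j r).factorial : ℚ))
        (Finset.mem_range.2 hap), ← mul_assoc]
    congr 1
    · obtain ⟨m, hm⟩ : ∃ m, shiftedLength p i j a = m + 1 :=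
        ⟨shiftedLength p i j a - 1, by
          have := ha.1
          rw [shiftedLength]
          omega⟩
      have hm' : shiftedLength p i' j a = m := by
        have := ha.1
        rw [shiftedLength] at hm ⊢
        rw [hself]
        omega
      rw [hm, hm', Nat.factorial_succ]
      push_cast
      ring
    · refine Finset.prod_congr rfl fun r hr => ?_
      rw [shiftedLength, shiftedLength, hne r (Finset.ne_of_mem_erase hr)]
  -- Only differences involving the row `a` change: `i b - i a` loses one for later `b`, and `i a -
  -- i r` gains one for earlier `r`. Both quotients, new by old, have the form `(L_a - L_b - 1)/(L_a
  -- - L_b)`.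
  have e4 : ∏ r ∈ Finset.range p, ∏ b ∈ laterRows p j r, ((i' b : ℚ) - i' r) =
      (∏ b ∈ (diagramRows p j a).erase a,
        (((shiftedLength p i j a : ℚ) - shiftedLength p i j b - 1) /
          ((shiftedLength p i j a : ℚ) - shiftedLength p i j b))) *
      ∏ r ∈ Finset.range p, ∏ b ∈ laterRows p j r, ((i b : ℚ) - i r) := by
    have e5 : ∀ b ∈ (diagramRows p j a).erase a,
        (((shiftedLength p i j a : ℚ) - shiftedLength p i j b - 1) /
          ((shiftedLength p i j a : ℚ) - shiftedLength p i j b)) =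
        ((i b : ℚ) - i a - 1) / ((i b : ℚ) - i a) := fun b hb => by
      rw [h.shiftedLength_sub hap (Finset.mem_of_mem_erase hb)]
    rw [Finset.prod_congr rfl e5, prod_diagramRows_erase hap,
      ← Finset.mul_prod_erase _ _ (Finset.mem_range.2 hap),
      ← Finset.mul_prod_erase (Finset.range p)
        (fun r => ∏ b ∈ laterRows p j r, ((i b : ℚ) - i r)) (Finset.mem_range.2 hap),
      mul_mul_mul_comm, ← Finset.prod_mul_distrib, ← Finset.prod_mul_distrib]
    congr 1
    · refine Finset.prod_congr rfl fun b hb => ?_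
      rw [div_mul_cancel₀ _ (hD a hap b hb), hself, hne b]
      · push_cast
        ring
      · rw [mem_laterRows] at hb
        omega
    · refine Finset.prod_congr rfl fun r hr => ?_
      rw [Finset.mem_erase, Finset.mem_range] at hr
      split_ifs with hr'
      · have hz := hD r hr.2 a hr'
        have hz' : (i r : ℚ) - i a ≠ 0 := by
          rw [← neg_sub]
          exact neg_ne_zero.2 hz
        rw [← Finset.mul_prod_erase _ _ hr', ← Finset.mul_prod_erase (laterRows p j r)
          (fun b => (i b : ℚ) - i r) hr', hself, hne r hr.1, ← mul_assoc]
        congr 1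
        · push_cast
          field_simp
          ring
        · refine Finset.prod_congr rfl fun b hb => ?_
          rw [hne b (Finset.ne_of_mem_erase hb)]
      · rw [one_mul]
        refine Finset.prod_congr rfl fun b hb => ?_
        rw [hne r hr.1, hne b (fun hba => hr' (hba ▸ hb))]
  have hD0 : ∏ r ∈ Finset.range p, ∏ b ∈ laterRows p j r, ((i b : ℚ) - i r) ≠ 0 :=
    Finset.prod_ne_zero_iff.2 fun r hr => Finset.prod_ne_zero_iff.2 fun b hb =>
      hD r (Finset.mem_range.1 hr) b hb
  have hH : (hookProd p i' j : ℚ) ≠ 0 := by exact_mod_cast (hookProd_pos p i' j).ne'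
  rw [div_eq_iff hH]
  apply mul_right_cancel₀ hD0
  rw [e1, e3, ← e2, e4]
  ring

/-- If the next row belongs to the same diagram, failure of the corner condition forces `i (a + 1) =
i a + 1`, and the factor of `b = a + 1` vanishes. If the row `a` is the last of its diagram, it must
be empty, and its shifted length is zero. -/
theorem term_eq_zero_of_not_isCorner (h : IsRowSystem n p i j) {a : ℕ} (hap : a < p)
    (ha : ¬ IsCorner p i j a) :
    shiftedLength p i j a * ∏ b ∈ (diagramRows p j a).erase a,
        (((shiftedLength p i j a : ℚ) - shiftedLength p i j b - 1) /
          ((shiftedLength p i j a : ℚ) - shiftedLength p i j b)) = 0 := by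
  have hle := h.le a hap
  by_cases hn : a + 1 < p ∧ j (a + 1) = j a + 1
  · have h1 := h.lower_lt a hn.1
    have h2 := h.le (a + 1) hn.1
    have h3 : i (a + 1) = i a + 1 := by
      by_contra h3
      exact ha ⟨by omega, fun _ => by omega⟩
    have hm : a + 1 ∈ diagramRows p j a := by
      rw [mem_diagramRows]
      omega
    rw [Finset.prod_eq_zero (i := a + 1) (Finset.mem_erase.2 ⟨by omega, hm⟩), mul_zero]
    rw [h.shiftedLength_sub hap hm, h3]
    push_cast
    simp
  · have h1 : i a = j a + 1 := by
      by_contra h1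
      refine ha ⟨by omega, fun h2 => ?_⟩
      have := h.conn a h2
      omega
    have h2 : laterRows p j a = ∅ := by
      by_cases h3 : a + 1 < p
      · exact h.laterRows_eq_empty h3 fun h4 => hn ⟨h3, h4⟩
      · rw [Finset.eq_empty_iff_forall_notMem]
        intro b hb
        rw [mem_laterRows] at hb
        omega
    rw [shiftedLength, h1, h2]
    simp

/-- The diagrams are the fibres of `j a - a`. On each of them the interpolation identity applies,
the shifted lengths being distinct, and the number of later rows which it subtracts is exactly the
shift, leaving the length of the row. -/
theorem sum_shiftedLength_mul_prod (h : IsRowSystem n p i j) :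
    ∑ a ∈ Finset.range p, shiftedLength p i j a * ∏ b ∈ (diagramRows p j a).erase a,
        (((shiftedLength p i j a : ℚ) - shiftedLength p i j b - 1) /
          ((shiftedLength p i j a : ℚ) - shiftedLength p i j b)) =
      ((∑ r ∈ Finset.range p, (j r + 1 - i r) : ℕ) : ℚ) := by
  set c : ℕ → ℤ := fun a => (j a : ℤ) - a with hc
  have hfib : ∀ y : ℤ, ∀ a ∈ (Finset.range p).filter (c · = y),
      diagramRows p j a = (Finset.range p).filter (c · = y) := by
    intro y a ha
    rw [Finset.mem_filter] at ha
    refine Finset.filter_congr fun b _ => ?_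
    rw [← ha.2]
    simp only [hc]
    omega
  have hmaps : ∀ a ∈ Finset.range p, c a ∈ (Finset.range p).image c :=
    fun a ha => Finset.mem_image_of_mem c ha
  rw [← Finset.sum_fiberwise_of_maps_to hmaps, ← Finset.sum_fiberwise_of_maps_to hmaps,
    Nat.cast_sum]
  refine Finset.sum_congr rfl fun y _ => ?_
  set s := (Finset.range p).filter (c · = y) with hs
  have e1 := sum_mul_prod_sub_one_div s (fun a => (shiftedLength p i j a : ℚ)) (by
    intro a ha b hb hab
    have hap : a < p := Finset.mem_range.1 (Finset.mem_of_mem_filter _ ha)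
    have hbp : b < p := Finset.mem_range.1 (Finset.mem_of_mem_filter _ hb)
    by_contra hne
    have hbd : b ∈ diagramRows p j a := by
      rw [hfib y a ha]
      exact hb
    refine h.lower_sub_ne_zero hap hbp hne ?_
    rw [← h.shiftedLength_sub hap hbd]
    exact sub_eq_zero.2 hab)
  have e2 : ∀ a ∈ s, shiftedLength p i j a * ∏ b ∈ (diagramRows p j a).erase a,
        (((shiftedLength p i j a : ℚ) - shiftedLength p i j b - 1) /
          ((shiftedLength p i j a : ℚ) - shiftedLength p i j b)) =
      shiftedLength p i j a * ∏ b ∈ s.erase a,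
        (((shiftedLength p i j a : ℚ) - shiftedLength p i j b - 1) /
          ((shiftedLength p i j a : ℚ) - shiftedLength p i j b)) := fun a ha => by
    rw [hfib y a ha]
  rw [Finset.sum_congr rfl e2, e1, Nat.cast_sum]
  refine Finset.sum_congr rfl fun a ha => ?_
  have e3 : s.filter (a < ·) = laterRows p j a := by
    rw [hs, ← hfib y a ha]
    ext b
    rw [Finset.mem_filter, mem_diagramRows, mem_laterRows]
    tauto
  rw [e3, shiftedLength, Nat.cast_add, add_sub_cancel_right]

/-- The hook length formula for the commutation class of the word of a system of rows. -/
theorem card_commClass_mul_hookProd {Q : SimpleQuiver (Fin n)} (hQ : Q.IsTypeA)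
    (h : IsRowSystem n p i j) :
    (Nat.card {M // CommEquiv (Far Q) (rowWord n p i j) M} : ℚ) * hookProd p i j =
      (∑ r ∈ Finset.range p, (j r + 1 - i r)).factorial := by
  induction hN : ∑ r ∈ Finset.range p, (j r + 1 - i r) generalizing i with
  | zero =>
    have h1 : ∀ r < p, j r < i r := fun r hr => by
      have := (Finset.sum_eq_zero_iff.1 hN) r (Finset.mem_range.2 hr)
      omega
    have h2 : hookProd p i j = 1 := by
      refine Finset.prod_eq_one fun r hr => ?_
      rw [Finset.Ico_eq_empty (by have := h1 r (Finset.mem_range.1 hr); omega), Finset.prod_empty]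
    rw [rowWord_eq_nil h1, card_commClass_nil, h2]
    simp
  | succ N ih =>
    have hne : ∃ r < p, i r ≤ j r := by
      by_contra hcon
      push Not at hcon
      rw [Finset.sum_eq_zero fun r hr => by
        have := hcon r (Finset.mem_range.1 hr)
        omega] at hN
      omega
    have hsum := h.sum_shiftedLength_mul_prod
    rw [← Finset.sum_filter_add_sum_filter_not (Finset.range p) (IsCorner p i j),
      Finset.sum_eq_zero (s := (Finset.range p).filter fun a => ¬ IsCorner p i j a) fun a ha => by
        rw [Finset.mem_filter, Finset.mem_range] at ha
        exact h.term_eq_zero_of_not_isCorner ha.1 ha.2, add_zero, hN] at hsum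
    rw [card_commClass_rowWord hQ h hne, Nat.cast_sum, Finset.sum_mul, Nat.factorial_succ,
      Nat.cast_mul, ← hsum, Finset.sum_mul]
    -- For each corner it remains to see that `f(λ - a) · H(λ)` equals `H(λ)/H(λ - a)` times `N!`,
    -- which is the induction hypothesis for `λ - a`.
    refine Finset.sum_congr rfl fun a ha => ?_
    rw [Finset.mem_filter, Finset.mem_range] at ha
    rw [← h.hookProd_div_hookProd_removeFirst ha.1 ha.2]
    have e1 : ∑ r ∈ Finset.range p, (j r + 1 - KLRDyck.removeFirst i a r) = N := by
      rw [← Finset.add_sum_erase _ _ (Finset.mem_range.2 ha.1)] at hN ⊢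
      have e2 : ∀ r ∈ (Finset.range p).erase a, j r + 1 - KLRDyck.removeFirst i a r =
          j r + 1 - i r := fun r hr => by
        rw [removeFirst_of_ne i (Finset.ne_of_mem_erase hr)]
      rw [Finset.sum_congr rfl e2, removeFirst_self]
      have := ha.2.1
      omega
    have hH : (hookProd p (KLRDyck.removeFirst i a) j : ℚ) ≠ 0 := by
      exact_mod_cast (hookProd_pos ..).ne'
    rw [← ih (h.removeFirst ha.2) e1]
    field_simp

end IsRowSystem

end RowSystemHooks

/-! ### The rows of a Dyck path -/

/-- The lower index of the `r`-th peak. -/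
def peakLower (D : DyckWord) (r : ℕ) : ℕ := lowerIndex ((peaks D).getD r (0, 0))

/-- The upper index of the `r`-th peak. -/
def peakUpper (D : DyckWord) (r : ℕ) : ℕ := upperIndex ((peaks D).getD r (0, 0))

/-- The positions of the rises of the peaks of `D`. -/
def peakPositions (D : DyckWord) : List ℕ :=
  (List.range D.toList.length).filter fun t => IsPeakPosition D t

theorem length_peakPositions (D : DyckWord) : (peakPositions D).length = (peaks D).length := by
  rw [peaks, List.length_map, peakPositions]

theorem mem_peakPositions {D : DyckWord} {t : ℕ} : t ∈ peakPositions D ↔ IsPeakPosition D t := by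
  rw [peakPositions, List.mem_filter, List.mem_range, decide_eq_true_eq, and_iff_right_iff_imp]
  intro h
  exact (List.getElem?_eq_some_iff.1 h.1).1

theorem peakPositions_lt {D : DyckWord} {r s : ℕ} (hs : s < (peakPositions D).length)
    (hrs : r < s) : (peakPositions D)[r] < (peakPositions D)[s] :=
  List.pairwise_iff_getElem.1 (List.pairwise_lt_range.filter _) r s _ hs hrs

/-- Between consecutive peaks there is no peak. -/
theorem not_isPeakPosition_between {D : DyckWord} {r t : ℕ}
    (hr : r + 1 < (peakPositions D).length) (h1 : (peakPositions D)[r] < t)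
    (h2 : t < (peakPositions D)[r + 1]) : ¬ IsPeakPosition D t := by
  intro h
  obtain ⟨m, hm, rfl⟩ := List.getElem_of_mem (mem_peakPositions.2 h)
  rcases lt_trichotomy m r with h3 | rfl | h3
  · have := peakPositions_lt (D := D) (by omega) h3
    omega
  · omega
  · rcases Nat.lt_or_eq_of_le (show r + 1 ≤ m from h3) with h4 | rfl
    · have := peakPositions_lt hm h4
      omega
    · omega

theorem count_take_succ {L : List DyckStep} {a : DyckStep} {t : ℕ} (h : L[t]? = some a)
    (c : DyckStep) : (L.take (t + 1)).count c = (L.take t).count c + if a = c then 1 else 0 := by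
  rw [List.take_add_one, h]
  cases a <;> cases c <;> simp

/-- The indices of a peak and its summit in terms of the numbers of rises and falls before it. -/
theorem peak_indices {D : DyckWord} {r : ℕ} (hr : r < (peakPositions D).length) :
    peakLower D r = (D.toList.take ((peakPositions D)[r] + 1)).count DyckStep.D + 1 ∧
      peakUpper D r + 1 = (D.toList.take ((peakPositions D)[r] + 1)).count DyckStep.U ∧
      peakLower D r ≤ peakUpper D r + 1 ∧
      (peaks D).getD r (0, 0) = (peakLower D r + peakUpper D r,
        peakUpper D r + 2 - peakLower D r) := by
  have hp : (peaks D).getD r (0, 0) =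
      ((peakPositions D)[r] + 1, pathHeight D ((peakPositions D)[r] + 1)) := by
    rw [List.getD_eq_getElem _ _ (by rwa [← length_peakPositions])]
    simp [peaks, peakPositions]
  have hpk := mem_peakPositions.1 (List.getElem_mem hr)
  set t := (peakPositions D)[r] with ht
  have hlen := (List.getElem?_eq_some_iff.1 hpk.1).1
  have h1 := lowerIndex_peak D (t + 1) (by omega)
  have h2 := count_take_succ hpk.1 DyckStep.U
  have h3 := count_take_succ hpk.1 DyckStep.D
  have h4 := D.count_D_le_count_U t
  simp only [if_true, reduceCtorEq, if_false, add_zero] at h2 h3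
  have h5 : peakLower D r = (D.toList.take (t + 1)).count DyckStep.D + 1 := by
    rw [peakLower, hp, h1.1]
  have h6 : peakUpper D r + 1 = (D.toList.take (t + 1)).count DyckStep.U := by
    rw [peakUpper, hp, h1.2]
    omega
  refine ⟨h5, h6, by omega, ?_⟩
  have h7 : (D.toList.take (t + 1)).count DyckStep.U + (D.toList.take (t + 1)).count DyckStep.D =
      t + 1 := by
    have h3 : ∀ L : List DyckStep, L.count DyckStep.U + L.count DyckStep.D = L.length := by
      intro L
      induction L with
      | nil => rfl
      | cons a L ih => cases a <;> simp [← ih] <;> omega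
    rw [h3, List.length_take, min_eq_left (by omega)]
  rw [hp, Prod.mk.injEq, pathHeight]
  omega

/-- Take the last fall before the peak; everything between it and the summit is a rise. -/
theorem exists_ascent {D : DyckWord} {t t' : ℕ} (h : t < t')
    (ht : D.toList[t]? = some DyckStep.D) (ht' : IsPeakPosition D t') :
    ∃ u, t ≤ u ∧ u < t' ∧ D.toList[u]? = some DyckStep.D ∧ IsAscent D (u + 1) (t' - u) := by
  obtain ⟨u, hu⟩ : ∃ u, u = Nat.findGreatest (fun v => D.toList[v]? = some DyckStep.D) t' :=
    ⟨_, rfl⟩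
  have h1 : D.toList[u]? = some DyckStep.D := by
    rw [hu]
    exact Nat.findGreatest_spec (P := fun v => D.toList[v]? = some DyckStep.D) h.le ht
  have h2 : t ≤ u := by
    rw [hu]
    exact Nat.le_findGreatest h.le ht
  have h3 : u ≤ t' := by
    rw [hu]
    exact Nat.findGreatest_le _
  have h4 : u ≠ t' := by
    rintro rfl
    rw [ht'.1] at h1
    cases h1
  refine ⟨u, h2, by omega, h1, by omega, fun r hr => ?_, Or.inr (by simpa using h1), ?_⟩
  · have h5 : ¬ D.toList[u + 1 + r]? = some DyckStep.D :=
      Nat.findGreatest_is_greatest (P := fun v => D.toList[v]? = some DyckStep.D) (n := t')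
        (by omega) (by omega)
    have h6 := (List.getElem?_eq_some_iff.1 ht'.1).1
    have h7 : u + 1 + r < D.toList.length := by omega
    rw [List.getElem?_eq_getElem h7] at h5 ⊢
    rcases DyckStep.dichotomy D.toList[u + 1 + r] with h8 | h8
    · rw [h8]
    · exact absurd (congrArg some h8) h5
  · rw [show u + 1 + (t' - u) = t' + 1 by omega, ht'.2]
    simp

theorem isRowSystem_peaks {n : ℕ} (D : DyckWord) (hD : D.semilength = n + 1)
    (hasc : ∀ s l : ℕ, IsAscent D s l → 1 < l → pathHeight D s = 0) :
    IsRowSystem n (peaks D).length (peakLower D) (peakUpper D) := by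
  rw [← length_peakPositions]
  have mono : ∀ (c : DyckStep) {a b : ℕ}, a ≤ b →
      (D.toList.take a).count c ≤ (D.toList.take b).count c := fun c a b hab =>
    (List.take_sublist_take_left hab).count_le _
  refine ⟨fun r hr => ?_, fun r hr => (peak_indices hr).2.2.1, fun r hr => ?_, fun r hr => ?_,
    fun r hr => ?_, fun r hr => ?_⟩
  · have := (peak_indices hr).1
    omega
  · have h1 := (peak_indices hr).2.1
    have h2 : (D.toList.take ((peakPositions D)[r] + 1)).count DyckStep.U ≤ n + 1 := by
      rw [← hD]
      exact (List.take_sublist _ _).count_le _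
    omega
  · have h1 := peak_indices (D := D) (r := r) (by omega)
    have h2 := peak_indices hr
    have h3 := peakPositions_lt hr (Nat.lt_succ_self r)
    have h4 := (mem_peakPositions.1 (List.getElem_mem (show r < (peakPositions D).length by omega))).2
    have h5 := count_take_lt le_rfl (show (peakPositions D)[r] + 1 < (peakPositions D)[r + 1] + 1 by
      omega) h4
    omega
  · have h1 := peak_indices (D := D) (r := r) (by omega)
    have h2 := peak_indices hr
    have h3 := peakPositions_lt hr (Nat.lt_succ_self r)
    have h4 := (mem_peakPositions.1 (List.getElem_mem hr)).1
    have h5 := count_take_lt (s := (peakPositions D)[r] + 1) (by omega)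
      (show (peakPositions D)[r + 1] < (peakPositions D)[r + 1] + 1 by omega) h4
    omega
  · obtain ⟨i1, j1, -, -⟩ := peak_indices (D := D) (r := r) (by omega)
    obtain ⟨i2, j2, -, -⟩ := peak_indices hr
    have hlt := peakPositions_lt hr (Nat.lt_succ_self r)
    have hbet := fun t => not_isPeakPosition_between (t := t) hr
    have hp := mem_peakPositions.1
      (List.getElem_mem (show r < (peakPositions D).length by omega))
    have hp' := mem_peakPositions.1 (List.getElem_mem hr)
    generalize (peakPositions D)[r] = t at *
    generalize (peakPositions D)[r + 1] = t' at *
    have hne : t + 1 ≠ t' := by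
      intro he
      have := hp'.1
      rw [← he, hp.2] at this
      cases this
    obtain ⟨u, h1, h2, h3, h4⟩ := exists_ascent (by omega) hp.2 hp'
    -- The ascent leading to the next peak has `t' - u` rises. If it is long, it begins on the axis,
    -- where the falls so far are as many as the rises, at least `j r + 1` in number; so the next
    -- lower end is at least `j r + 2`.
    by_cases hl : 1 < t' - u
    · right
      have h5 := hasc _ _ h4 hl
      rw [pathHeight] at h5
      have h6 := mono DyckStep.D (show u + 1 ≤ t' + 1 by omega)
      have h7 := mono DyckStep.U (show t + 1 ≤ u + 1 by omega)
      omega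
    · left
      obtain rfl : t' = u + 1 := by omega
      -- Going backwards from `u`, a rise would be followed by a fall and give a peak between the
      -- two. So only falls separate the peaks, and the number of rises grows by just one.
      have hfall : ∀ d v, v + d = u → t < v → D.toList[v]? = some DyckStep.D := by
        intro d
        induction d with
        | zero =>
          intro v hv _
          rw [← hv] at h3
          exact h3
        | succ d ih =>
          intro v hv htv
          have h5 := ih (v + 1) (by omega) (by omega)
          have h6 : v < D.toList.length := by
            have := (List.getElem?_eq_some_iff.1 h3).1
            omega
          rcases DyckStep.dichotomy D.toList[v] with h8 | h8
          · exact absurd ⟨by rw [List.getElem?_eq_getElem h6, h8], h5⟩ (hbet v htv (by omega))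
          · rw [List.getElem?_eq_getElem h6, h8]
      have hcount : ∀ d, t + 1 + d ≤ u + 1 → (D.toList.take (t + 1 + d)).count DyckStep.U =
          (D.toList.take (t + 1)).count DyckStep.U := by
        intro d hd
        induction d with
        | zero => rfl
        | succ d ih =>
          have h5 := count_take_succ (hfall (u - (t + 1 + d)) (t + 1 + d) (by omega) (by omega))
            DyckStep.U
          simp only [reduceCtorEq, if_false, add_zero] at h5
          rw [← add_assoc, h5, ih (by omega)]
      have h5 := hcount (u - t) (by omega)
      rw [show t + 1 + (u - t) = u + 1 by omega] at h5
      have h6 := count_take_succ hp'.1 DyckStep.U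
      simp only [if_true] at h6
      omega

theorem reverse_flatMap_segment (n : ℕ) (l : List (ℕ × ℕ)) :
    (l.flatMap fun q => segment n (lowerIndex q) (upperIndex q)).reverse =
      rowWord n l.length (fun r => lowerIndex (l.getD r (0, 0)))
        (fun r => upperIndex (l.getD r (0, 0))) := by
  induction l using List.reverseRecOn with
  | nil => rfl
  | append_singleton l q ih =>
    rw [List.flatMap_append, List.reverse_append, ih, List.length_append, List.length_singleton,
      rowWord]
    have hlt : ∀ r < l.length, (l ++ [q]).getD r (0, 0) = l.getD r (0, 0) := fun r hr =>
      List.getD_append _ _ _ _ hr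
    have hq : (l ++ [q]).getD l.length (0, 0) = q := by
      rw [List.getD_append_right _ _ _ _ le_rfl]
      simp
    rw [hq, rowWord_congr (fun r hr => congrArg lowerIndex (hlt r hr))
      fun r hr => congrArg upperIndex (hlt r hr)]
    simp [rowList]

theorem reverse_peakWord (n : ℕ) (D : DyckWord) :
    (peakWord n D).reverse = rowWord n (peaks D).length (peakLower D) (peakUpper D) :=
  reverse_flatMap_segment n (peaks D)

theorem sum_map_eq_sum_range {β : Type*} (l : List β) (d : β) (f : β → ℕ) :
    (l.map f).sum = ∑ r ∈ Finset.range l.length, f (l.getD r d) := by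
  induction l with
  | nil => rfl
  | cons a l ih =>
    rw [List.map_cons, List.sum_cons, ih, List.length_cons, Finset.sum_range_succ', add_comm]
    simp

/-- The height of a peak is one more than the length of its row; peaks of height one give empty
rows. -/
theorem dyckDegree_eq (D : DyckWord) : dyckDegree D =
    ∑ r ∈ Finset.range (peaks D).length, (peakUpper D r + 1 - peakLower D r) := by
  have h : ∑ r ∈ Finset.range (peaks D).length, ((peaks D).getD r (0, 0)).2 =
      ∑ r ∈ Finset.range (peaks D).length, ((peakUpper D r + 1 - peakLower D r) + 1) := by
    refine Finset.sum_congr rfl fun r hr => ?_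
    rw [Finset.mem_range, ← length_peakPositions] at hr
    obtain ⟨-, -, h1, h2⟩ := peak_indices hr
    rw [h2]
    dsimp only
    omega
  rw [dyckDegree, sum_map_eq_sum_range _ (0, 0), h, Finset.sum_add_distrib]
  simp

/-! ### Extended ascents as rows and subpaths as hooks -/

theorem onExtendedAscent_iff {D : DyckWord} {x y : ℕ} : OnExtendedAscent D x y ↔
    ∃ r < (peaks D).length, y + peakLower D r ≤ peakUpper D r + 2 ∧
      2 * peakLower D r + y = x + 2 := by
  have key : ∀ r < (peaks D).length,
      (y ≤ ((peaks D).getD r (0, 0)).2 ∧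
        ((peaks D).getD r (0, 0)).1 + y = x + ((peaks D).getD r (0, 0)).2 ↔
      y + peakLower D r ≤ peakUpper D r + 2 ∧ 2 * peakLower D r + y = x + 2) := by
    intro r hr
    rw [← length_peakPositions] at hr
    obtain ⟨-, -, h1, h2⟩ := peak_indices hr
    rw [h2]
    dsimp only
    omega
  constructor
  · rintro ⟨q, hq, h⟩
    obtain ⟨r, hr, rfl⟩ := List.getElem_of_mem hq
    refine ⟨r, hr, (key r hr).1 ?_⟩
    rwa [List.getD_eq_getElem _ _ hr]
  · rintro ⟨r, hr, h⟩
    refine ⟨(peaks D).getD r (0, 0), ?_, (key r hr).2 h⟩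
    rw [List.getD_eq_getElem _ _ hr]
    exact List.getElem_mem hr

/-- The number of rises of the descending part of a subpath that starts at the point
`(y + 2 * z, y)`, where the rows from `s` on are those with extended ascents further right. -/
theorem count_descend {n : ℕ} {D : DyckWord}
    (h : IsRowSystem n (peaks D).length (peakLower D) (peakUpper D)) (fuel y z s J f : ℕ)
    (hf : s + f = (peaks D).length) (hJ : J + 1 = y + z)
    (hlow : ∀ r < s, peakLower D r ≤ z + 1) (hhigh : 0 < f → z + 1 < peakLower D s)
    (hup : 0 < f → J < peakUpper D s) (hfuel : y + f ≤ fuel) :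
    (descend D fuel (y + 2 * z) y).count DyckStep.U = leg (peakLower D) f s J := by
  have hz : y = 0 ∨ f = 0 → leg (peakLower D) f s J = 0 := by
    intro h0
    match f with
    | 0 => rfl
    | f + 1 =>
      have := hhigh (by omega)
      rw [leg, if_neg (by omega)]
  induction fuel generalizing y z s J f with
  | zero =>
    rw [hz (by omega)]
    rfl
  | succ fuel ih =>
    match y with
    | 0 =>
      rw [hz (by omega)]
      rfl
    | y + 1 =>
      -- After the fall the path is on the line of slope one from `(2 * (z + 1), 0)`, the line of a
      -- row with lower end `z + 2`. Rows before `s` have their lines further left and rows after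
      -- `s` start beyond that of `s`. By `hup` the ascent of the row `s` is long enough to be hit.
      have hon : OnExtendedAscent D (y + 1 + 2 * z + 1) y ↔ 0 < f ∧ peakLower D s = z + 2 := by
        rw [onExtendedAscent_iff]
        constructor
        · rintro ⟨r, hr, h1, h2⟩
          have h3 : s ≤ r := by
            by_contra h3
            have := hlow r (by omega)
            omega
          rcases Nat.lt_or_eq_of_le h3 with h4 | rfl
          · have h5 := h.lower_strictMono h4 hr
            have h6 := hhigh (by omega)
            omega
          · omega
        · rintro ⟨h1, h2⟩
          have := hup h1
          exact ⟨s, by omega, by omega, by omega⟩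
      rw [descend, List.count_cons_of_ne (by simp)]
      -- With `i_s = z + 2`, positive height after the fall means `i_s ≤ J + 1`, the condition for
      -- another row in the leg. The step up moves the path to the antidiagonal of the letter `J +
      -- 1`.
      by_cases hc : 0 < y ∧ OnExtendedAscent D (y + 1 + 2 * z + 1) y
      · rw [if_pos hc, List.count_cons_self]
        obtain ⟨hy, hf0, hs⟩ := And.imp_right hon.1 hc
        obtain ⟨f, rfl⟩ : ∃ g, f = g + 1 := ⟨f - 1, by omega⟩
        rw [leg, if_pos (by omega), show y + 1 + 2 * z + 2 = (y + 1) + 2 * (z + 1) by ring]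
        have hlow' : ∀ r < s + 1, peakLower D r ≤ z + 1 + 1 := by
          intro r hr
          rcases Nat.lt_succ_iff_lt_or_eq.1 hr with hr | rfl
          · have := hlow r hr
            omega
          · omega
        have hhigh' : 0 < f → z + 1 + 1 < peakLower D (s + 1) := fun hf' => by
          have := h.lower_lt s (by omega)
          omega
        have hup' : 0 < f → J + 1 < peakUpper D (s + 1) := fun hf' => by
          have := h.upper_lt s (by omega)
          have := hup (by omega)
          omega
        rw [ih (y + 1) (z + 1) (s + 1) (J + 1) f (by omega) (by omega) hlow' hhigh' hup' (by omega)]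
        rintro (h0 | rfl)
        · omega
        · rfl
      · rw [if_neg hc, show y + 1 + 2 * z + 1 = y + 2 * (z + 1) by ring]
        rcases Nat.eq_zero_or_pos y with rfl | hy
        · rw [show descend D fuel (0 + 2 * (z + 1)) 0 = [] by cases fuel <;> rfl]
          match f with
          | 0 => rfl
          | f + 1 =>
            have := hhigh (by omega)
            rw [leg, if_neg (by omega)]
            rfl
        · have hs : 0 < f → peakLower D s ≠ z + 2 := fun hf0 hs => hc ⟨hy, hon.2 ⟨hf0, hs⟩⟩
          refine ih y (z + 1) s J f hf (by omega) (fun r hr => ?_) (fun hf0 => ?_) hup (by omega) ?_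
          · have := hlow r hr
            omega
          · have := hs hf0
            have := hhigh hf0
            omega
          · rintro (h0 | rfl)
            · omega
            · rfl

theorem pNumber_eq_hook {n : ℕ} {D : DyckWord} (hD : D.semilength = n + 1)
    (h : IsRowSystem n (peaks D).length (peakLower D) (peakUpper D)) {r J : ℕ}
    (hr : r < (peaks D).length) (h1 : peakLower D r ≤ J) (h2 : J ≤ peakUpper D r) :
    pNumber D (peakLower D r) J = hook (peaks D).length (peakLower D) r J := by
  have h3 := h.pos r hr
  have h4 := h.bound r hr
  have hlen : D.toList.length = 2 * (n + 1) := by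
    rw [← hD]
    exact D.two_mul_semilength_eq_length.symm
  -- Each fall lowers the path for good or uses up a row. With at most `n + 1` rows, the bound of `2
  -- * (n + 1)` falls is therefore sufficient.
  have h5 : (peaks D).length ≤ n + 1 := by
    have h6 := h.add_le_upper (show 0 ≤ (peaks D).length - 1 by omega) (by omega)
    have h7 := h.bound ((peaks D).length - 1) (by omega)
    omega
  have key := count_descend h D.toList.length (J - peakLower D r + 2) (peakLower D r - 1) (r + 1) J
    ((peaks D).length - (r + 1)) (by omega) (by omega) (fun s hs => by
      rcases Nat.lt_succ_iff_lt_or_eq.1 hs with hs | rfl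
      · have := h.lower_strictMono hs hr
        omega
      · omega) (fun h0 => by
      have := h.lower_lt r (by omega)
      omega) (fun h0 => by
      have := h.upper_lt r (by omega)
      omega) (by omega)
  rw [show J - peakLower D r + 2 + 2 * (peakLower D r - 1) = peakLower D r + J by omega] at key
  rw [pNumber, subpath, List.count_append, List.count_replicate_self, key, hook]
  omega

/-- Different peaks have different lower ends, so a block on an extended ascent determines its row,
and blocks correspond to boxes. -/
theorem prod_ascentBlocks {n : ℕ} {D : DyckWord} (hD : D.semilength = n + 1)
    (h : IsRowSystem n (peaks D).length (peakLower D) (peakUpper D)) :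
    ∏ b ∈ ascentBlocks n D, pNumber D b.1 b.2 =
      hookProd (peaks D).length (peakLower D) (peakUpper D) := by
  rw [hookProd, Finset.prod_sigma']
  symm
  refine Finset.prod_bij (fun x _ => (peakLower D x.1, x.2)) ?_ ?_ ?_ ?_
  · rintro ⟨r, J⟩ hx
    rw [Finset.mem_sigma, Finset.mem_range, Finset.mem_Ico] at hx
    dsimp only at hx ⊢
    have h1 := h.pos r hx.1
    have h2 := h.bound r hx.1
    rw [ascentBlocks, Finset.mem_filter, Finset.mem_product, Finset.mem_Icc, Finset.mem_Icc,
      onExtendedAscent_iff]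
    dsimp only
    exact ⟨by omega, by omega, r, hx.1, by omega, by omega⟩
  · rintro ⟨r, J⟩ hx ⟨s, K⟩ hy hxy
    rw [Finset.mem_sigma, Finset.mem_range, Finset.mem_Ico] at hx hy
    dsimp only at hx hy hxy
    rw [Prod.mk.injEq] at hxy
    obtain rfl := hxy.2
    rcases lt_trichotomy r s with h1 | rfl | h1
    · have := h.lower_strictMono h1 hy.1
      omega
    · rfl
    · have := h.lower_strictMono h1 hx.1
      omega
  · rintro ⟨a, J⟩ hb
    rw [ascentBlocks, Finset.mem_filter, Finset.mem_product, Finset.mem_Icc, Finset.mem_Icc,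
      onExtendedAscent_iff] at hb
    dsimp only at hb
    obtain ⟨hb1, hb2, r, hr, hb3, hb4⟩ := hb
    obtain rfl : a = peakLower D r := by omega
    exact ⟨⟨r, J⟩, by
      rw [Finset.mem_sigma, Finset.mem_range, Finset.mem_Ico]
      dsimp only
      omega, rfl⟩
  · rintro ⟨r, J⟩ hx
    rw [Finset.mem_sigma, Finset.mem_range, Finset.mem_Ico] at hx
    dsimp only at hx ⊢
    exact (pNumber_eq_hook hD h hx.1 hx.2.1 (by omega)).symm

end KLRDyck

theorem proposition3p1 (F : Type*) [Field F] {n : ℕ}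
    (Q : KLRDyck.SimpleQuiver (Fin n)) (hQ : Q.IsTypeA)
    (D : DyckWord) (hD : D.semilength = n + 1)
    (hasc : ∀ s l : ℕ, KLRDyck.IsAscent D s l → 1 < l → KLRDyck.pathHeight D s = 0) :
    (Module.finrank F (KLRDyck.HomogeneousModule F (KLRDyck.dyckComponent Q hQ D hD)) : ℚ) =
      (Nat.factorial (KLRDyck.dyckDegree D) : ℚ) /
        ∏ b ∈ KLRDyck.ascentBlocks n D, (KLRDyck.pNumber D b.1 b.2 : ℚ) := by
  have h := KLRDyck.isRowSystem_peaks D hD hasc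
  have hcard : Module.finrank F (KLRDyck.HomogeneousModule F (KLRDyck.dyckComponent Q hQ D hD)) =
      Nat.card {M // KLRDyck.CommEquiv (KLRDyck.Far Q) (KLRDyck.rowWord n (KLRDyck.peaks D).length
        (KLRDyck.peakLower D) (KLRDyck.peakUpper D)) M} := by
    rw [KLRDyck.finrank_homogeneousModule, ← KLRDyck.reverse_peakWord,
      KLRDyck.card_commClass_reverse KLRDyck.Far.symm]
    refine (KLRDyck.card_supp (Q := Q) (KLRDyck.Word.ofList (KLRDyck.peakWord n D))).trans ?_
    rw [KLRDyck.ofFn_ofList]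
  rw [← Nat.cast_prod, KLRDyck.prod_ascentBlocks hD h, hcard, KLRDyck.dyckDegree_eq,
    ← h.card_commClass_mul_hookProd hQ, mul_div_cancel_right₀]
  exact_mod_cast (KLRDyck.hookProd_pos ..).ne'
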